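/- All Hilbert spaces are complex. Let $T$ be a 2-isometry on a Hilbert space $H$, i.e. a bounded operator with $I-2T^*T+T^{*2}T^2=0$ (then $T^*T$ is invertible), and let $T'=T(T^*T)^{-1}$ be its Cauchy dual. Say that a contraction $S$ on $H$ is of class $C_{0\cdot}$ (resp. $C_{\cdot 0}$) if $S^nf\to0$ (resp. $S^{*n}f\to 0$) as $n\to\infty$ for all $f\in H$, and of class $C_{00}$ if it is of both classes. Say that $T$ is completely non-unitary if there is no nonzero closed subspace $L$ of $H$ reducing $T$ such that $T|_L$ is a unitary operator on $L$. (i) $T'$ is of class $C_{\cdot0}$ (in particular a contraction) if and only if $T$ is completely non-unitary. Assume moreover that $T$ satisfies the kernel condition $T^*T(\ker T^*)\subseteq\ker T^*$. By a model measure for $T$ we mean a compactly supported $B(M)$-valued Borel spectral measure $E$ on $[1,\infty)$, for some Hilbert space $M$, such that $T$ is unitarily equivalent to the operator valued unilateral weighted shift $W(h_0,h_1,\dots)=(0,W_0h_0,W_1h_1,\dots)$ on $\ell^2_M$ with weights $$W_n=\int_{[1,\infty)}\xi_n\,dE,\qquad \xi_n(x)=\sqrt{\frac{1+(n+1)(x^2-1)}{1+n(x^2-1)}}\qquad(n\ge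 0).$$ (We allow $M=\{0\}$, which occurs only when $H=\{0\}$.) Then: (ii) $T'$ is of class $C_{0\cdot}$ if and only if $T$ is completely non-unitary and $E(\{1\})=0$ for some model measure $E$ for $T$. Likewise, $T'$ is of class $C_{0\cdot}$ if and only if $T$ is completely non-unitary and $E(\{1\})=0$ for every model measure $E$ for $T$. (iii) $T'$ is of class $C_{0\cdot}$ if and only if $T'$ is of class $C_{00}$, and if and only if $G_T(\{1\})=0$, where $G_T$ is the spectral measure of $T^*T$, i.e. the compactly supported $B(H)$-valued Borel spectral measure on $\mathbb R$ with $T^*T=\int_{\mathbb R}t\,G_T(dt)$. -/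

import Mathlib

universe u

open MeasureTheory Filter Topology ContinuousLinearMap

/-! ### Classes of operators -/

section Operators

variable {H : Type*} [NormedAddCommGroup H] [InnerProductSpace ℂ H] [CompleteSpace H]

/-- `T` is a 2-isometry: `I - 2 T*T + T*²T² = 0`. -/
def IsTwoIsometry (T : H →L[ℂ] H) : Prop :=
  1 - 2 • (adjoint T * T) + adjoint T ^ 2 * T ^ 2 = 0

/-- The Cauchy dual `T' = T (T*T)⁻¹`. The inverse is the one in the ring `B(H)`; it exists exactly
when `T` is left-invertible, in particular for every 2-isometry (where `T*T ≥ I`). -/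
noncomputable def cauchyDual (T : H →L[ℂ] H) : H →L[ℂ] H :=
  T * Ring.inverse (adjoint T * T)

/-- The kernel condition: `T*T (ker T*) ⊆ ker T*`. -/
def KernelCondition (T : H →L[ℂ] H) : Prop :=
  ∀ x : H, adjoint T x = 0 → adjoint T (adjoint T (T x)) = 0

/-- The subspace `L` reduces `T`: both `L` and its orthogonal complement are invariant. -/
def Reduces (L : Submodule ℂ H) (T : H →L[ℂ] H) : Prop :=
  (∀ x ∈ L, T x ∈ L) ∧ ∀ x ∈ Lᗮ, T x ∈ Lᗮ

/-- `T` is completely non-unitary: no nonzero closed subspace `L` reduces `T` to a unitary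
operator of `L` (a linear isometry of `L` onto `L`). -/
def IsCompletelyNonUnitary (T : H →L[ℂ] H) : Prop :=
  ∀ L : Submodule ℂ H, IsClosed (L : Set H) → Reduces L T →
    (∃ U : L ≃ₗᵢ[ℂ] L, ∀ x : L, (U x : H) = T x) → L = ⊥

/-- `S` is a contraction of class `C_{0·}`: `Sⁿ f → 0` for all `f`. -/
def IsClassCZeroDot (S : H →L[ℂ] H) : Prop :=
  ‖S‖ ≤ 1 ∧ ∀ f : H, Tendsto (fun n : ℕ => (S ^ n) f) atTop (𝓝 0)

/-- `S` is a contraction of class `C_{·0}`: `S*ⁿ f → 0` for all `f`. -/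
def IsClassCDotZero (S : H →L[ℂ] H) : Prop :=
  ‖S‖ ≤ 1 ∧ ∀ f : H, Tendsto (fun n : ℕ => (adjoint S ^ n) f) atTop (𝓝 0)

/-- Class `C_{00}`. -/
def IsClassCZeroZero (S : H →L[ℂ] H) : Prop :=
  IsClassCZeroDot S ∧ IsClassCDotZero S

end Operators

/-! ### Spectral measures -/

/-- A `B(M)`-valued spectral measure on a measurable space `X`: orthogonal projections, normalized,
multiplicative, and countably additive in the strong operator topology. Only the values on
measurable sets matter. -/
structure OpSpectralMeasure (X : Type*) [MeasurableSpace X] (M : Type*)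
    [NormedAddCommGroup M] [InnerProductSpace ℂ M] [CompleteSpace M] where
  proj : Set X → M →L[ℂ] M
  isStarProjection : ∀ A, MeasurableSet A → IsStarProjection (proj A)
  empty : proj ∅ = 0
  univ : proj Set.univ = 1
  inter : ∀ A B, MeasurableSet A → MeasurableSet B → proj (A ∩ B) = proj A * proj B
  iUnion : ∀ A : ℕ → Set X, (∀ n, MeasurableSet (A n)) →
    Pairwise (fun m n => Disjoint (A m) (A n)) →
    ∀ x : M, HasSum (fun n => proj (A n) x) (proj (⋃ n, A n) x)

namespace OpSpectralMeasure

variable {X : Type*} [MeasurableSpace X] {M : Type*}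
  [NormedAddCommGroup M] [InnerProductSpace ℂ M] [CompleteSpace M]

theorem re_inner_nonneg (E : OpSpectralMeasure X M) (x : M) {A : Set X} (hA : MeasurableSet A) :
    0 ≤ (inner ℂ x (E.proj A x)).re := by
  have h := E.isStarProjection A hA
  have h1 : E.proj A x = E.proj A (E.proj A x) := by
    have := h.isIdempotentElem
    exact (congrArg (fun P : M →L[ℂ] M => P x) this).symm
  have h2 : adjoint (E.proj A) = E.proj A := h.isSelfAdjoint
  rw [h1, ← ContinuousLinearMap.adjoint_inner_left, h2]
  exact inner_self_nonneg (𝕜 := ℂ)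

/-- The positive measure `A ↦ ⟨E(A)x, x⟩`. -/
noncomputable def scalar (E : OpSpectralMeasure X M) (x : M) : Measure X :=
  Measure.ofMeasurable (fun A _ => ENNReal.ofReal (inner ℂ x (E.proj A x)).re)
    (by simp [E.empty])
    (by
      intro A hA hd
      have h1 := E.iUnion A hA hd x
      have h2 : HasSum (fun n => (inner ℂ x (E.proj (A n) x)).re)
          (inner ℂ x (E.proj (⋃ n, A n) x)).re :=
        Complex.hasSum_re (h1.mapL (innerSL ℂ x))
      rw [← h2.tsum_eq]
      exact ENNReal.ofReal_tsum_of_nonneg (fun n => E.re_inner_nonneg x (hA n)) h2.summable)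

/-- `A = ∫ f dE` for a real function `f` and a bounded operator `A`, in the usual weak sense:
`⟨Ax, x⟩ = ∫ f(t) ⟨E(dt)x, x⟩` for all `x` (which determines `A`). -/
def HasIntegral (E : OpSpectralMeasure X M) (f : X → ℝ) (A : M →L[ℂ] M) : Prop :=
  ∀ x : M, Integrable f (E.scalar x) ∧
    inner ℂ x (A x) = ((∫ t, f t ∂(E.scalar x) : ℝ) : ℂ)

/-- `E` has compact support. -/
def CompactlySupported [TopologicalSpace X] (E : OpSpectralMeasure X M) : Prop :=
  ∃ K : Set X, IsCompact K ∧ E.proj Kᶜ = 0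

end OpSpectralMeasure

/-- `G` is the spectral measure of the bounded selfadjoint operator `A`: a compactly supported
spectral measure on the real line with `A = ∫ t G(dt)`. -/
def IsSpectralMeasureOf {H : Type*} [NormedAddCommGroup H] [InnerProductSpace ℂ H]
    [CompleteSpace H] (G : OpSpectralMeasure ℝ H) (A : H →L[ℂ] H) : Prop :=
  G.CompactlySupported ∧ G.HasIntegral (fun t => t) A

/-! ### The model -/

/-- `ξ_n(x) = √((1 + (n+1)(x²-1)) / (1 + n(x²-1)))` on `[1,∞)`. -/
noncomputable def xi (n : ℕ) (x : Set.Ici (1 : ℝ)) : ℝ :=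
  Real.sqrt ((1 + ((n : ℝ) + 1) * ((x : ℝ) ^ 2 - 1)) / (1 + (n : ℝ) * ((x : ℝ) ^ 2 - 1)))

/-- `W` is the operator valued unilateral weighted shift on `ℓ²_M` with weights `w n`, that is
`W (h₀, h₁, …) = (0, w₀ h₀, w₁ h₁, …)`. -/
def IsOpWeightedShift {M : Type*} [NormedAddCommGroup M] [InnerProductSpace ℂ M]
    (W : lp (fun _ : ℕ => M) 2 →L[ℂ] lp (fun _ : ℕ => M) 2) (w : ℕ → M →L[ℂ] M) : Prop :=
  ∀ h : lp (fun _ : ℕ => M) 2, W h 0 = 0 ∧ ∀ n : ℕ, W h (n + 1) = w n (h n)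

/-- `T` is unitarily equivalent to the operator valued unilateral weighted shift on `ℓ²_M` with
weights `w n = ∫ ξ_n dE`, where `E` is a compactly supported `B(M)`-valued Borel spectral measure
on `[1,∞)`. -/
def IsModelMeasure {H : Type*} [NormedAddCommGroup H] [InnerProductSpace ℂ H]
    {M : Type*} [NormedAddCommGroup M] [InnerProductSpace ℂ M] [CompleteSpace M]
    (E : OpSpectralMeasure (Set.Ici (1 : ℝ)) M) (T : H →L[ℂ] H) : Prop :=
  E.CompactlySupported ∧
    ∃ (w : ℕ → M →L[ℂ] M) (W : lp (fun _ : ℕ => M) 2 →L[ℂ] lp (fun _ : ℕ => M) 2)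
      (U : H ≃ₗᵢ[ℂ] lp (fun _ : ℕ => M) 2),
      (∀ n, E.HasIntegral (xi n) (w n)) ∧ IsOpWeightedShift W w ∧ ∀ x : H, U (T x) = W (U x)

/-- The point `1` of `[1,∞)`. -/
def oneIci : Set.Ici (1 : ℝ) := ⟨1, Set.mem_Ici.2 le_rfl⟩

/-! ### The spectral measure of a representation of `C(X, ℝ)` -/

/-! Write `T'` for the Cauchy dual and `D = T*T - 1`. For a 2-isometry `‖Tⁿx‖² = ‖x‖² + n⟨Dx, x⟩`,
so `D ≥ 0`, and `T'*` is a contractive left inverse of `T`.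

(i) The powers of `T'*` are contractions, so they tend strongly to 0 once the spaces `ker T'*ⁿ` have
dense union. Let `x` be orthogonal to all of them and put `vₙ = Tⁿ T'*ⁿ x`. Then `x - vₙ ∈ ker
T'*ⁿ`, hence `⟨vₙ, x⟩ = ‖x‖²`. A comparison with the harmonic series bounds a subsequence of `vₙ`
(`frequently_norm_pow_apply_adjoint_pow_le`). If `T` is completely non-unitary, then `⋂ ran Tⁿ = 0`
(`iInf_range_pow_eq_bot`), so this subsequence tends weakly to 0 and `x = 0`. Conversely, on a
unitary summand `T'*ⁿ` inverts `Tⁿ` and preserves norms.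

(ii), (iii) The kernel condition gives `T*T T = 2T - T'`, hence `T'*ⁿ T'ⁿ (1 + nD) = 1`
(`adjoint_pow_cauchyDual_pow`). So `T'ⁿ` is isometric on `ker D` and tends to 0 on `ran D`, and
class `C_{0·}` means `ker D = 0`. This rules out unitary summands, and it says exactly that `G_T`,
or any model measure, has no atom at 1.

The measures must also be shown to exist. `G_T` comes from the Riesz–Markov theorem and strong
limits. A model measure comes from a Wold-type decomposition of `H` into the ranges of `Tⁿ(1 + n(C -
1))^(-1/2)`, where `C` is the restriction of `T*T` to `ker T*`. -/

theorem eq_of_inner_self_eq {K : Type*} [NormedAddCommGroup K] [InnerProductSpace ℂ K]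
    {S T : K →L[ℂ] K} (h : ∀ x, inner ℂ x (S x) = inner ℂ x (T x)) : S = T := by
  refine ContinuousLinearMap.coe_injective ((ext_inner_map (S : K →ₗ[ℂ] K) T).1 fun x => ?_)
  have := congrArg (starRingEnd ℂ) (h x)
  rwa [inner_conj_symm, inner_conj_symm] at this

namespace CRep

section

variable {X : Type*} [TopologicalSpace X]
  {K : Type*} [NormedAddCommGroup K] [InnerProductSpace ℂ K] [CompleteSpace K]
  (φ : C(X, ℝ) →⋆ₐ[ℝ] (K →L[ℂ] K))

theorem adjoint_apply (f : C(X, ℝ)) : adjoint (φ f) = φ f := by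
  rw [← star_eq_adjoint, ← map_star]
  congr 1

theorem inner_mul (f g : C(X, ℝ)) (x : K) :
    inner ℂ (φ f x) (φ g x) = inner ℂ x (φ (f * g) x) := by
  rw [map_mul]
  change _ = inner ℂ x (φ f (φ g x))
  rw [← adjoint_inner_left (φ f), adjoint_apply]

theorem inner_apply_eq_norm_sq (f g : C(X, ℝ)) (hg : g * g = f) (x : K) :
    inner ℂ x (φ f x) = ((‖φ g x‖ ^ 2 : ℝ) : ℂ) := by
  rw [← hg, ← inner_mul, inner_self_eq_norm_sq_to_K]
  norm_cast

/-- Since `f = (√f)²`, the form equals `‖φ(√f) x‖²`. -/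
theorem inner_nonneg (f : C(X, ℝ)) (hf : 0 ≤ f) (x : K) : 0 ≤ (inner ℂ x (φ f x)).re := by
  let g : C(X, ℝ) := ⟨fun t => Real.sqrt (f t), by fun_prop⟩
  have hg : g * g = f := by
    ext t
    exact Real.mul_self_sqrt (hf t)
  rw [inner_apply_eq_norm_sq φ f g hg, Complex.ofReal_re]
  positivity

theorem inner_eq_re (f : C(X, ℝ)) (x : K) :
    inner ℂ x (φ f x) = ((inner ℂ x (φ f x)).re : ℂ) := by
  refine (Complex.conj_eq_iff_re.1 ?_).symm
  rw [inner_conj_symm, ← adjoint_inner_right, adjoint_apply]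

end

variable {X : Type*} [MetricSpace X] [CompactSpace X] [MeasurableSpace X] [BorelSpace X]
  {K : Type*} [NormedAddCommGroup K] [InnerProductSpace ℂ K] [CompleteSpace K]
  (φ : C(X, ℝ) →⋆ₐ[ℝ] (K →L[ℂ] K))

/-- Riesz–Markov–Kakutani for the positive functional `f ↦ ⟨x, φ(f) x⟩`; on a compact space every
continuous function has compact support. -/
theorem exists_measure (x : K) : ∃ μ : Measure X, IsFiniteMeasure μ ∧
    ∀ f : C(X, ℝ), inner ℂ x (φ f x) = ((∫ t, f t ∂μ : ℝ) : ℂ) := by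
  let Λ : CompactlySupportedContinuousMap X ℝ →ₚ[ℝ] ℝ := PositiveLinearMap.mk₀
    { toFun := fun f => (inner ℂ x (φ f.toContinuousMap x)).re
      map_add' := fun f g => by
        have : (f + g).toContinuousMap = f.toContinuousMap + g.toContinuousMap := rfl
        rw [this, map_add, add_apply, inner_add_right, Complex.add_re]
      map_smul' := fun c f => by
        have : (c • f).toContinuousMap = c • f.toContinuousMap := rfl
        rw [this, map_smul, smul_apply, inner_smul_right_eq_smul, Complex.smul_re]
        rfl }
    (fun f hf => inner_nonneg φ _ (fun t => hf t) x)
  refine ⟨RealRMK.rieszMeasure Λ, inferInstance, fun f => ?_⟩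
  have h := RealRMK.integral_rieszMeasure Λ (CompactlySupportedContinuousMap.continuousMapEquiv f)
  rw [inner_eq_re]
  exact congrArg _ h.symm

/-- The measure `f ↦ ⟨x, φ(f) x⟩`. -/
noncomputable def μ (x : K) : Measure X := (exists_measure φ x).choose

instance (x : K) : IsFiniteMeasure (μ φ x) := (exists_measure φ x).choose_spec.1

theorem inner_eq_integral (f : C(X, ℝ)) (x : K) :
    inner ℂ x (φ f x) = ((∫ t, f t ∂(μ φ x) : ℝ) : ℂ) :=
  (exists_measure φ x).choose_spec.2 f

theorem norm_sq_eq_integral (f : C(X, ℝ)) (x : K) :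
    ‖φ f x‖ ^ 2 = ∫ t, f t ^ 2 ∂(μ φ x) := by
  have h := inner_eq_integral φ (f * f) x
  rw [inner_apply_eq_norm_sq φ (f * f) f rfl] at h
  rw [Complex.ofReal_inj.1 h]
  simp [sq]

theorem norm_le_one (f : C(X, ℝ)) (hf : ∀ t, f t ∈ Set.Icc (0 : ℝ) 1) : ‖φ f‖ ≤ 1 := by
  refine opNorm_le_bound _ zero_le_one fun x => ?_
  rw [one_mul]
  refine le_of_sq_le_sq ?_ (norm_nonneg x)
  have h1 := norm_sq_eq_integral φ 1 x
  rw [map_one, one_apply_eq_self] at h1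
  rw [norm_sq_eq_integral, h1]
  refine integral_mono (Continuous.integrable_of_hasCompactSupport (by fun_prop)
    (HasCompactSupport.of_compactSpace _)) (Continuous.integrable_of_hasCompactSupport
    (by fun_prop) (HasCompactSupport.of_compactSpace _)) fun t => ?_
  have := hf t
  exact pow_le_pow_left₀ this.1 this.2 2


theorem integrable (f : C(X, ℝ)) (x : K) : Integrable (fun t => f t) (μ φ x) :=
  f.continuous.integrable_of_hasCompactSupport (HasCompactSupport.of_compactSpace _)

theorem integrable_indicator {A : Set X} (hA : MeasurableSet A) (x : K) :
    Integrable (A.indicator fun _ => (1 : ℝ)) (μ φ x) :=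
  (integrable_const _).indicator hA

/-- Nets of continuous functions with values in `[0,1]` that approximate an indicator function in
`L¹` of all the measures `⟨x, φ(·) x⟩` simultaneously. -/
theorem exists_approx {A : Set X} (hA : MeasurableSet A) :
    ∃ f : Finset K × ℕ → C(X, ℝ), (∀ i t, f i t ∈ Set.Icc (0 : ℝ) 1) ∧
      ∀ x, Tendsto (fun i => ∫ t, |A.indicator (fun _ => (1 : ℝ)) t - f i t| ∂(μ φ x))
        atTop (𝓝 0) := by
  have key : ∀ i : Finset K × ℕ, ∃ f : C(X, ℝ), (∀ t, f t ∈ Set.Icc (0 : ℝ) 1) ∧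
      ∀ x ∈ i.1, ∫ t, |A.indicator (fun _ => (1 : ℝ)) t - f t| ∂(μ φ x) ≤ 1 / ((i.2 : ℝ) + 1) := by
    rintro ⟨s, n⟩
    -- Approximation in `L¹` of the sum handles all `x ∈ s` at once, because each `μ φ x` is
    -- dominated by `ν`. Clamping the approximant to `[0,1]` brings it no further from the
    -- indicator.
    let ν : Measure X := ∑ x ∈ s, μ φ x
    have hpos : (0 : ℝ) < 1 / ((n : ℝ) + 1) := by positivity
    obtain ⟨g, hg, hgi⟩ := Integrable.exists_boundedContinuous_integral_sub_le (μ := ν)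
      ((integrable_const (1 : ℝ)).indicator hA) hpos
    refine ⟨⟨fun t => max 0 (min 1 (g t)), by fun_prop⟩,
      fun t => ⟨le_max_left _ _, max_le zero_le_one (min_le_left _ _)⟩, fun x hx => ?_⟩
    refine le_trans (integral_mono ?_ ?_ fun t => ?_) (le_trans (integral_mono_measure
      (f := fun t => |A.indicator (fun _ => (1 : ℝ)) t - g t|) (ν := ν) ?_ ?_ ?_) hg)
    · exact ((integrable_indicator φ hA x).sub (integrable φ _ x)).abs
    · exact ((integrable_indicator φ hA x).sub (integrable φ g.toContinuousMap x)).abs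
    · change |A.indicator (fun _ => (1 : ℝ)) t - max 0 (min 1 (g t))| ≤ _
      have hb : A.indicator (fun _ => (1 : ℝ)) t ∈ Set.Icc (0 : ℝ) 1 := by
        by_cases h : t ∈ A <;> simp [h]
      obtain ⟨h0, h1⟩ := hb
      generalize A.indicator (fun _ => (1 : ℝ)) t = a at h0 h1 ⊢
      generalize g t = b
      rcases le_total 1 b with hb | hb
      · rw [min_eq_left hb, max_eq_right zero_le_one, abs_of_nonpos (by linarith),
          abs_of_nonpos (by linarith)]
        linarith
      · rw [min_eq_right hb]
        rcases le_total 0 b with hb' | hb'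
        · rw [max_eq_right hb']
        · rw [max_eq_left hb', abs_of_nonneg (by linarith), abs_of_nonneg (by linarith)]
          linarith
    · exact Finset.single_le_sum (f := fun x => μ φ x) (fun _ _ => Measure.zero_le _) hx
    · exact Eventually.of_forall fun t => abs_nonneg _
    · exact (((integrable_const (1 : ℝ)).indicator hA).sub hgi).abs
  choose f hf hfl using key
  refine ⟨f, hf, fun x => ?_⟩
  have h0 : Tendsto (fun i : Finset K × ℕ => 1 / ((i.2 : ℝ) + 1)) atTop (𝓝 0) := by
    rw [← prod_atTop_atTop_eq]
    exact tendsto_one_div_add_atTop_nhds_zero_nat.comp tendsto_snd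
  refine tendsto_of_tendsto_of_tendsto_of_le_of_le' tendsto_const_nhds h0
    (Eventually.of_forall fun i => integral_nonneg fun t => abs_nonneg _) ?_
  filter_upwards [eventually_ge_atTop (({x}, 0) : Finset K × ℕ)] with i hi
  exact hfl i x (hi.1 (Finset.mem_singleton_self x))

theorem tendsto_integral_mul {A : Set X} (hA : MeasurableSet A) {ι : Type*} {l : Filter ι}
    {f : ι → C(X, ℝ)} {x : K}
    (hf : Tendsto (fun i => ∫ t, |A.indicator (fun _ => (1 : ℝ)) t - f i t| ∂(μ φ x)) l (𝓝 0))
    {h : X → ℝ} (hm : Measurable h) (hb : ∀ t, |h t| ≤ 1) :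
    Tendsto (fun i => ∫ t, f i t * h t ∂(μ φ x)) l
      (𝓝 (∫ t, A.indicator (fun _ => (1 : ℝ)) t * h t ∂(μ φ x))) := by
  rw [tendsto_iff_norm_sub_tendsto_zero]
  refine squeeze_zero (fun _ => norm_nonneg _) (fun i => ?_) hf
  have hi : ∀ {u : X → ℝ}, Integrable u (μ φ x) → Integrable (fun t => u t * h t) (μ φ x) :=
    fun hu => hu.mul_bdd (c := 1) hm.aestronglyMeasurable (Eventually.of_forall hb)
  rw [← integral_sub (hi (integrable φ _ x)) (hi (integrable_indicator φ hA x))]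
  refine (norm_integral_le_integral_norm _).trans (integral_mono ?_ ?_ fun t => ?_)
  · exact ((hi (integrable φ _ x)).sub (hi (integrable_indicator φ hA x))).norm
  · exact ((integrable_indicator φ hA x).sub (integrable φ _ x)).abs
  · simp only [Real.norm_eq_abs]
    rw [← sub_mul, abs_mul, abs_sub_comm]
    exact mul_le_of_le_one_right (abs_nonneg _) (hb t)

/-- `‖φ(f - g) x‖² = ∫ (f - g)² ≤ ∫ |f - g|` when `f`, `g` take values in `[0,1]`, so an `L¹`-Cauchy
net gives Cauchy vectors. The uniform bound `norm_le_one` makes the limit a bounded operator. -/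
theorem exists_strong_limit {A : Set X} (hA : MeasurableSet A) {f : Finset K × ℕ → C(X, ℝ)}
    (hf : ∀ i t, f i t ∈ Set.Icc (0 : ℝ) 1)
    (hl : ∀ x, Tendsto (fun i => ∫ t, |A.indicator (fun _ => (1 : ℝ)) t - f i t| ∂(μ φ x))
      atTop (𝓝 0)) :
    ∃ P : K →L[ℂ] K, ∀ x, Tendsto (fun i => φ (f i) x) atTop (𝓝 (P x)) := by
  classical
  have hc : ∀ x, ∃ y, Tendsto (fun i => φ (f i) x) atTop (𝓝 y) := by
    intro x
    refine cauchySeq_tendsto_of_complete (Metric.cauchySeq_iff.2 fun ε hε => ?_)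
    have he : (0 : ℝ) < ε ^ 2 / 2 := by positivity
    obtain ⟨N, hN⟩ := eventually_atTop.1 ((hl x).eventually (gt_mem_nhds he))
    refine ⟨N, fun m hm n hn => ?_⟩
    rw [dist_eq_norm, ← sub_apply, ← map_sub]
    refine lt_of_pow_lt_pow_left₀ 2 hε.le ?_
    rw [norm_sq_eq_integral]
    have h1 : ∫ t, (f m - f n) t ^ 2 ∂(μ φ x) ≤
        ∫ t, (|A.indicator (fun _ => (1 : ℝ)) t - f m t| +
          |A.indicator (fun _ => (1 : ℝ)) t - f n t|) ∂(μ φ x) := by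
      refine integral_mono (integrable φ ((f m - f n) ^ 2) x)
        (((integrable_indicator φ hA x).sub (integrable φ _ x)).abs.add
          ((integrable_indicator φ hA x).sub (integrable φ _ x)).abs) fun t => ?_
      have h2 := hf m t
      have h3 := hf n t
      have h4 : |f m t - f n t| ≤ 1 := abs_le.2 ⟨by linarith [h2.1, h3.2], by linarith [h2.2, h3.1]⟩
      change (f m t - f n t) ^ 2 ≤ _
      rw [← sq_abs]
      refine (pow_le_of_le_one (abs_nonneg _) h4 two_ne_zero).trans ?_
      rw [abs_sub_comm _ (f m t)]
      exact abs_sub_le _ _ _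
    have h2 := integral_add ((integrable_indicator φ hA x).sub (integrable φ (f m) x)).abs
      ((integrable_indicator φ hA x).sub (integrable φ (f n) x)).abs
    exact h1.trans_lt (h2.trans_lt ((add_lt_add (hN m hm) (hN n hn)).trans_eq (add_halves _)))
  choose P hP using hc
  refine ⟨ofTendstoOfBoundedRange P (fun i => φ (f i)) (tendsto_pi_nhds.2 hP) ?_, hP⟩
  refine isBounded_iff_forall_norm_le.2 ⟨1, ?_⟩
  rintro _ ⟨i, rfl⟩
  exact norm_le_one φ _ (hf i)

/-- A family of strong limits with the expected matrix coefficients. -/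
theorem exists_family : ∃ P : Set X → K →L[ℂ] K, ∀ A, MeasurableSet A →
    adjoint (P A) = P A ∧ (∀ x, inner ℂ x (P A x) = (((μ φ x).real A : ℝ) : ℂ)) ∧
    ∀ B, MeasurableSet B → ∀ x, inner ℂ x (P A (P B x)) = (((μ φ x).real (A ∩ B) : ℝ) : ℂ) := by
  classical
  have key : ∀ A : Set X, ∃ (P : K →L[ℂ] K) (f : Finset K × ℕ → C(X, ℝ)), MeasurableSet A →
      (∀ i t, f i t ∈ Set.Icc (0 : ℝ) 1) ∧
      (∀ x, Tendsto (fun i => ∫ t, |A.indicator (fun _ => (1 : ℝ)) t - f i t| ∂(μ φ x))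
        atTop (𝓝 0)) ∧ ∀ x, Tendsto (fun i => φ (f i) x) atTop (𝓝 (P x)) := by
    intro A
    by_cases hA : MeasurableSet A
    · obtain ⟨f, hf, hl⟩ := exists_approx φ hA
      obtain ⟨P, hP⟩ := exists_strong_limit φ hA hf hl
      exact ⟨P, f, fun _ => ⟨hf, hl, hP⟩⟩
    · exact ⟨0, 0, fun h => absurd h hA⟩
  choose P f h using key
  refine ⟨P, fun A hA => ?_⟩
  obtain ⟨hf, hl, hP⟩ := h A hA
  have hint : ∀ (x : K) (S : Set X), MeasurableSet S →
      ∫ t, S.indicator (fun _ => (1 : ℝ)) t ∂(μ φ x) = (μ φ x).real S := fun x S hS =>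
    integral_indicator_one hS
  have hind : ∀ (S : Set X) (t : X), |S.indicator (fun _ => (1 : ℝ)) t| ≤ 1 := fun S t => by
    by_cases ht : t ∈ S <;> simp [ht]
  refine ⟨?_, fun x => ?_, fun B hB x => ?_⟩
  · refine (eq_of_inner_self_eq fun x => ?_).symm
    rw [adjoint_inner_right]
    refine tendsto_nhds_unique (tendsto_const_nhds.inner (hP x)) ?_
    refine ((hP x).inner (tendsto_const_nhds (x := x))).congr fun i => ?_
    rw [← adjoint_inner_right, adjoint_apply]
  · refine tendsto_nhds_unique (tendsto_const_nhds.inner (hP x)) ?_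
    have := tendsto_integral_mul φ hA (hl x) (h := fun _ => 1) measurable_const (by simp)
    simp only [mul_one, hint x A hA] at this
    exact ((Complex.continuous_ofReal.tendsto _).comp this).congr fun i =>
      (inner_eq_integral φ (f A i) x).symm
  · obtain ⟨hf', hl', hP'⟩ := h B hB
    -- An iterated limit: the approximants of `B` go to the limit first, with that of `A` fixed.
    -- Only separate `L¹` convergence is then needed.
    have h1 : ∀ i, inner ℂ x (φ (f A i) (P B x)) =
        ((∫ t, f A i t * B.indicator (fun _ => (1 : ℝ)) t ∂(μ φ x) : ℝ) : ℂ) := by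
      intro i
      have h2 := tendsto_integral_mul φ hB (hl' x) (h := fun t => f A i t)
        (f A i).continuous.measurable
        (fun t => abs_le.2 ⟨by linarith [(hf i t).1], (hf i t).2⟩)
      have h3 : Tendsto (fun j => inner ℂ x (φ (f A i) (φ (f B j) x))) atTop
          (𝓝 (inner ℂ x (φ (f A i) (P B x)))) :=
        tendsto_const_nhds.inner (((φ (f A i)).continuous.tendsto _).comp (hP' x))
      refine tendsto_nhds_unique h3 ?_
      simp only [mul_comm (B.indicator (fun _ => (1 : ℝ)) _)] at h2
      refine ((Complex.continuous_ofReal.tendsto _).comp h2).congr fun j => ?_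
      have h4 := inner_eq_integral φ (f A i * f B j) x
      rw [map_mul] at h4
      simp only [ContinuousMap.mul_apply] at h4
      simp only [Function.comp_apply, mul_comm (f B j _)]
      exact h4.symm
    refine tendsto_nhds_unique (tendsto_const_nhds.inner (hP (P B x))) ?_
    have h5 := tendsto_integral_mul φ hA (hl x) (h := B.indicator (fun _ => (1 : ℝ)))
      (measurable_const.indicator hB) (hind B)
    have h6 : ∀ t, A.indicator (fun _ => (1 : ℝ)) t * B.indicator (fun _ => (1 : ℝ)) t =
        (A ∩ B).indicator (fun _ => (1 : ℝ)) t := fun t => by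
      rw [← Set.inter_indicator_mul]; simp
    simp only [h6, hint x _ (hA.inter hB)] at h5
    exact ((Complex.continuous_ofReal.tendsto _).comp h5).congr fun i => (h1 i).symm

/-- Algebraic identities are read off from quadratic forms. Countable additivity holds because the
remainder of a partial sum is the projection of the set left over, and `‖P(A) x‖²` is its `μ φ
x`-mass, which tends to 0. -/
theorem exists_opSpectralMeasure : ∃ E : OpSpectralMeasure X K,
    ∀ f : C(X, ℝ), E.HasIntegral f (φ f) := by
  obtain ⟨P, hP⟩ := exists_family φ
  have hmul : ∀ A B, MeasurableSet A → MeasurableSet B → P (A ∩ B) = P A * P B :=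
    fun A B hA hB => eq_of_inner_self_eq fun x => by
      rw [(hP _ (hA.inter hB)).2.1]
      exact ((hP A hA).2.2 B hB x).symm
  have hnorm : ∀ A, MeasurableSet A → ∀ x, ‖P A x‖ ^ 2 = (μ φ x).real A := by
    intro A hA x
    have h := (hP A hA).2.2 A hA x
    rw [← adjoint_inner_left, (hP A hA).1, inner_self_eq_norm_sq_to_K, Set.inter_self] at h
    exact Complex.ofReal_inj.1 (by rw [← h]; norm_cast)
  have hE : ∃ E : OpSpectralMeasure X K, E.proj = P := by
    refine ⟨⟨P, fun A hA => ⟨?_, (hP A hA).1⟩, ?_, ?_, hmul, ?_⟩, rfl⟩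
    · exact (hmul A A hA hA).symm.trans (by rw [Set.inter_self])
    · refine eq_of_inner_self_eq fun x => ?_
      rw [(hP ∅ MeasurableSet.empty).2.1]
      simp
    · refine eq_of_inner_self_eq fun x => ?_
      rw [(hP _ MeasurableSet.univ).2.1]
      have := inner_eq_integral φ 1 x
      rw [map_one] at this
      rw [this]
      simp
    · intro A hA hd x
      have hU := MeasurableSet.iUnion hA
      have hreal : HasSum (fun n => (μ φ x).real (A n)) ((μ φ x).real (⋃ n, A n)) := by
        have h1 := measure_iUnion (μ := μ φ x) hd hA
        have h2 := ENNReal.hasSum_toReal (h1 ▸ measure_ne_top (μ φ x) (⋃ n, A n))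
        rwa [← ENNReal.tsum_toReal_eq fun n => measure_ne_top _ _, ← h1] at h2
      have hfin : ∀ s : Finset ℕ, P (⋃ n, A n) - ∑ n ∈ s, P (A n) =
          P ((⋃ n, A n) \ ⋃ n ∈ s, A n) := by
        intro s
        have hs : MeasurableSet (⋃ n ∈ s, A n) := s.measurableSet_biUnion fun n _ => hA n
        refine eq_of_inner_self_eq fun y => ?_
        rw [sub_apply, sum_apply, inner_sub_right, inner_sum, (hP _ hU).2.1,
          (hP _ (hU.diff hs)).2.1, Finset.sum_congr rfl fun n _ => (hP _ (hA n)).2.1 y,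
          measureReal_sdiff (Set.iUnion₂_subset fun n _ => Set.subset_iUnion A n) hs,
          measureReal_biUnion_finset (fun m _ n _ hmn => hd hmn) fun n _ => hA n]
        push_cast
        rfl
      rw [HasSum, SummationFilter.unconditional_filter, tendsto_iff_norm_sub_tendsto_zero]
      have hsq : Tendsto (fun s : Finset ℕ => ‖∑ n ∈ s, P (A n) x - P (⋃ n, A n) x‖ ^ 2) atTop
          (𝓝 0) := by
        have h2 := (tendsto_const_nhds (x := (μ φ x).real (⋃ n, A n))).sub hreal
        rw [sub_self] at h2
        refine h2.congr fun s => ?_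
        have hs : MeasurableSet (⋃ n ∈ s, A n) := s.measurableSet_biUnion fun n _ => hA n
        have h3 := hnorm _ (hU.diff hs) x
        rw [← hfin s, sub_apply, sum_apply, norm_sub_rev] at h3
        rw [h3, measureReal_sdiff (Set.iUnion₂_subset fun n _ => Set.subset_iUnion A n) hs,
          measureReal_biUnion_finset (fun m _ n _ hmn => hd hmn) fun n _ => hA n]
      have h4 := hsq.sqrt
      simpa only [Real.sqrt_sq (norm_nonneg _), Real.sqrt_zero] using h4
  obtain ⟨E, rfl⟩ := hE
  refine ⟨E, fun f x => ?_⟩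
  have hs : E.scalar x = μ φ x := by
    refine Measure.ext fun A hA => ?_
    rw [OpSpectralMeasure.scalar, Measure.ofMeasurable_apply _ hA, (hP A hA).2.1, Complex.ofReal_re,
      ofReal_measureReal]
  rw [hs]
  exact ⟨integrable φ f x, inner_eq_integral φ f x⟩

end CRep

/-! ### Push-forwards, and spectral measures of selfadjoint operators -/

namespace OpSpectralMeasure

variable {X Y : Type*} [MeasurableSpace X] [MeasurableSpace Y] {K : Type*} [NormedAddCommGroup K]
  [InnerProductSpace ℂ K] [CompleteSpace K]

theorem scalar_apply (E : OpSpectralMeasure X K) (x : K) {A : Set X} (hA : MeasurableSet A) :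
    E.scalar x A = ENNReal.ofReal (inner ℂ x (E.proj A x)).re :=
  Measure.ofMeasurable_apply _ hA

/-- The push-forward of a spectral measure. -/
noncomputable def map (E : OpSpectralMeasure X K) {g : X → Y} (hg : Measurable g) :
    OpSpectralMeasure Y K where
  proj A := E.proj (g ⁻¹' A)
  isStarProjection A hA := E.isStarProjection _ (hg hA)
  empty := E.empty
  univ := E.univ
  inter A B hA hB := E.inter _ _ (hg hA) (hg hB)
  iUnion A hA hd x := by
    rw [Set.preimage_iUnion]
    exact E.iUnion _ (fun n => hg (hA n)) (fun m n hmn => (hd hmn).preimage g) x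

theorem scalar_map (E : OpSpectralMeasure X K) {g : X → Y} (hg : Measurable g) (x : K) :
    (E.map hg).scalar x = (E.scalar x).map g :=
  Measure.ext fun A hA => by
    rw [scalar_apply _ _ hA, Measure.map_apply hg hA, scalar_apply _ _ (hg hA)]
    rfl

theorem HasIntegral.map {E : OpSpectralMeasure X K} {g : X → Y} (hg : Measurable g) {f : Y → ℝ}
    (hf : Measurable f) {S : K →L[ℂ] K} (h : E.HasIntegral (fun t => f (g t)) S) :
    (E.map hg).HasIntegral f S := fun x => by
  rw [scalar_map]
  refine ⟨(integrable_map_measure hf.aestronglyMeasurable hg.aemeasurable).2 (h x).1, ?_⟩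
  rw [integral_map hg.aemeasurable hf.aestronglyMeasurable]
  exact (h x).2

end OpSpectralMeasure

/-- The representation is the continuous functional calculus. Allowing all continuous `f` yields
both the operator itself and, later, the weights of the model. -/
theorem IsSelfAdjoint.exists_opSpectralMeasure {K : Type*} [NormedAddCommGroup K]
    [InnerProductSpace ℂ K] [CompleteSpace K] {C : K →L[ℂ] K} (hC : IsSelfAdjoint C) :
    ∃ E : OpSpectralMeasure (spectrum ℝ C) K, ∀ f : ℝ → ℝ, Continuous f →
      E.HasIntegral (fun t => f t) (cfc f C) := by
  obtain ⟨E, hE⟩ := CRep.exists_opSpectralMeasure (cfcHom hC)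
  refine ⟨E, fun f hf => ?_⟩
  rw [cfc_apply f C hC hf.continuousOn]
  have h := hE ⟨_, hf.continuousOn.domRestrict⟩
  exact fun x => h x

theorem IsSelfAdjoint.exists_isSpectralMeasureOf {K : Type*} [NormedAddCommGroup K]
    [InnerProductSpace ℂ K] [CompleteSpace K] {C : K →L[ℂ] K} (hC : IsSelfAdjoint C) :
    ∃ G : OpSpectralMeasure ℝ K, IsSpectralMeasureOf G C := by
  obtain ⟨E, hE⟩ := hC.exists_opSpectralMeasure
  refine ⟨E.map measurable_subtype_coe, ⟨spectrum ℝ C, spectrum.isCompact C, ?_⟩,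
    OpSpectralMeasure.HasIntegral.map _ measurable_id ?_⟩
  · change E.proj _ = 0
    rw [Set.preimage_compl, Subtype.coe_preimage_self, Set.compl_univ, E.empty]
  · have := hE (fun t => t) continuous_id
    rwa [cfc_id' ℝ C] at this

theorem inner_self_eq_ofReal {E : Type*} [NormedAddCommGroup E] [InnerProductSpace ℂ E] (x : E) :
    inner ℂ x x = ((‖x‖ ^ 2 : ℝ) : ℂ) := by
  rw [inner_self_eq_norm_sq_to_K]
  norm_cast

/-! ### 2-isometries and their Cauchy duals -/

section

variable {H : Type*} [NormedAddCommGroup H] [InnerProductSpace ℂ H] [CompleteSpace H]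

theorem exists_norm_sub_lt_of_iSup_orthogonal_eq_bot {K : ℕ → Submodule ℂ H} (hK : Monotone K)
    (h : ∀ x, (∀ n, ∀ y ∈ K n, inner ℂ y x = 0) → x = 0) (x : H) {ε : ℝ} (hε : 0 < ε) :
    ∃ N, ∃ y ∈ K N, ‖x - y‖ < ε := by
  have htop : (⨆ n, K n).topologicalClosure = ⊤ := by
    rw [Submodule.topologicalClosure_eq_top_iff, Submodule.eq_bot_iff]
    exact fun z hz => h z fun n y hy => hz y (Submodule.mem_iSup_of_mem n hy)
  have hx : x ∈ closure ((⨆ n, K n : Submodule ℂ H) : Set H) := by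
    rw [← Submodule.topologicalClosure_coe, htop]
    trivial
  obtain ⟨y, hy, hxy⟩ := Metric.mem_closure_iff.1 hx ε hε
  obtain ⟨N, hN⟩ := (Submodule.mem_iSup_of_directed _ hK.directed_le).1 hy
  exact ⟨N, y, hN, by rwa [← dist_eq_norm]⟩

/-- With `D = R*R`, the form is `‖Rx‖²`. -/
theorem apply_eq_zero_of_nonneg {D : H →L[ℂ] H} (hD : 0 ≤ D) {x : H} (hx : inner ℂ x (D x) = 0) :
    D x = 0 := by
  obtain ⟨R, rfl⟩ := CStarAlgebra.nonneg_iff_eq_star_mul_self.1 hD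
  change inner ℂ x (adjoint R (R x)) = 0 at hx
  rw [adjoint_inner_right, inner_self_eq_zero] at hx
  change adjoint R (R x) = 0
  rw [hx, map_zero]

theorem inner_adjoint_apply_self (T : H →L[ℂ] H) (x : H) :
    inner ℂ x (adjoint T (T x)) = ((‖T x‖ ^ 2 : ℝ) : ℂ) := by
  rw [adjoint_inner_right, inner_self_eq_ofReal]

namespace IsTwoIsometry

variable {T : H →L[ℂ] H}

theorem apply_adjoint_sq (hT : IsTwoIsometry T) (x : H) :
    adjoint T (adjoint T (T (T x))) = (2 : ℂ) • adjoint T (T x) - x := by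
  have h := congrArg (fun S : H →L[ℂ] H => S x) hT
  have h' : x - 2 • adjoint T (T x) + adjoint T (adjoint T (T (T x))) = 0 := h
  rw [two_smul] at h' ⊢
  rw [← sub_eq_zero, ← h']
  abel

theorem norm_sq_apply_apply (hT : IsTwoIsometry T) (x : H) :
    ‖T (T x)‖ ^ 2 = 2 * ‖T x‖ ^ 2 - ‖x‖ ^ 2 := by
  have h := congrArg (inner ℂ x) (hT.apply_adjoint_sq x)
  rw [adjoint_inner_right, inner_adjoint_apply_self, inner_sub_right, inner_smul_right,
    inner_adjoint_apply_self, inner_self_eq_ofReal] at h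
  exact_mod_cast h

/-- The second differences of `n ↦ ‖Tⁿx‖²` vanish, so this sequence is affine. -/
theorem norm_sq_pow (hT : IsTwoIsometry T) (n : ℕ) (x : H) :
    ‖(T ^ n) x‖ ^ 2 = ‖x‖ ^ 2 + n * (‖T x‖ ^ 2 - ‖x‖ ^ 2) := by
  induction n generalizing x with
  | zero => simp
  | succ n ih =>
    rw [pow_succ]
    change ‖(T ^ n) (T x)‖ ^ 2 = _
    rw [ih, hT.norm_sq_apply_apply]
    push_cast
    ring

/-- A negative slope would eventually make the affine function `‖Tⁿx‖²` negative. -/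
theorem norm_le_norm_apply (hT : IsTwoIsometry T) (x : H) : ‖x‖ ≤ ‖T x‖ := by
  by_contra! h
  have h1 : 0 < ‖x‖ ^ 2 - ‖T x‖ ^ 2 :=
    sub_pos.2 (pow_lt_pow_left₀ h (norm_nonneg _) two_ne_zero)
  obtain ⟨n, hn⟩ := exists_nat_gt (‖x‖ ^ 2 / (‖x‖ ^ 2 - ‖T x‖ ^ 2))
  rw [div_lt_iff₀ h1] at hn
  have h2 := hT.norm_sq_pow n x
  nlinarith [sq_nonneg ‖(T ^ n) x‖]

theorem norm_le_norm_pow (hT : IsTwoIsometry T) (n : ℕ) (x : H) : ‖x‖ ≤ ‖(T ^ n) x‖ := by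
  refine le_of_sq_le_sq ?_ (norm_nonneg _)
  rw [hT.norm_sq_pow]
  have := pow_le_pow_left₀ (norm_nonneg x) (hT.norm_le_norm_apply x) 2
  exact le_add_of_nonneg_right (mul_nonneg n.cast_nonneg (sub_nonneg.2 this))

theorem gram_sub_one_nonneg (hT : IsTwoIsometry T) : 0 ≤ adjoint T * T - 1 := by
  rw [nonneg_iff_isPositive, isPositive_iff_complex]
  intro x
  have h : inner ℂ ((adjoint T * T - 1) x) x = ((‖T x‖ ^ 2 - ‖x‖ ^ 2 : ℝ) : ℂ) := by
    change inner ℂ (adjoint T (T x) - x) x = _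
    rw [inner_sub_left, adjoint_inner_left, inner_self_eq_ofReal, inner_self_eq_ofReal]
    push_cast
    rfl
  rw [h]
  refine ⟨by rw [RCLike.re_to_complex, Complex.ofReal_re], ?_⟩
  rw [RCLike.re_to_complex, Complex.ofReal_re]
  exact sub_nonneg.2 (pow_le_pow_left₀ (norm_nonneg x) (hT.norm_le_norm_apply x) 2)

theorem adjoint_apply_eq_of_norm_eq (hT : IsTwoIsometry T) {x : H} (hx : ‖T x‖ = ‖x‖) :
    adjoint T (T x) = x := by
  refine sub_eq_zero.1 (apply_eq_zero_of_nonneg hT.gram_sub_one_nonneg (x := x) ?_)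
  change inner ℂ x (adjoint T (T x) - x) = 0
  rw [inner_sub_right, inner_adjoint_apply_self, inner_self_eq_norm_sq_to_K, hx]
  simp

theorem isUnit_gram (hT : IsTwoIsometry T) : IsUnit (adjoint T * T) := by
  refine isUnit_of_forall_le_norm_inner_map _ (c := 1) one_pos fun x => ?_
  change _ ≤ ‖inner ℂ (adjoint T (T x)) x‖
  rw [adjoint_inner_left, inner_self_eq_norm_sq_to_K]
  have := pow_le_pow_left₀ (norm_nonneg x) (hT.norm_le_norm_apply x) 2
  simpa using this

theorem gram_inverse_apply (hT : IsTwoIsometry T) (x : H) :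
    adjoint T (T (Ring.inverse (adjoint T * T) x)) = x :=
  congrArg (fun S : H →L[ℂ] H => S x) (Ring.mul_inverse_cancel _ hT.isUnit_gram)

theorem inverse_gram_apply (hT : IsTwoIsometry T) (x : H) :
    Ring.inverse (adjoint T * T) (adjoint T (T x)) = x :=
  congrArg (fun S : H →L[ℂ] H => S x) (Ring.inverse_mul_cancel _ hT.isUnit_gram)

theorem adjoint_cauchyDual_apply (hT : IsTwoIsometry T) (x : H) :
    adjoint (cauchyDual T) x = Ring.inverse (adjoint T * T) (adjoint T x) := by
  refine ext_inner_right ℂ fun y => ?_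
  rw [adjoint_inner_left]
  change inner ℂ x (T (Ring.inverse (adjoint T * T) y)) = _
  rw [← adjoint_inner_left]
  conv_lhs => rw [← hT.gram_inverse_apply (adjoint T x)]
  rw [adjoint_inner_left, ← adjoint_inner_right, hT.gram_inverse_apply]

theorem adjoint_cauchyDual_apply_apply (hT : IsTwoIsometry T) (x : H) :
    adjoint (cauchyDual T) (T x) = x := by
  rw [hT.adjoint_cauchyDual_apply, hT.inverse_gram_apply]

theorem adjoint_cauchyDual_pow_apply_pow (hT : IsTwoIsometry T) (n : ℕ) (x : H) :
    (adjoint (cauchyDual T) ^ n) ((T ^ n) x) = x := by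
  induction n generalizing x with
  | zero => simp
  | succ n ih =>
    rw [pow_succ, pow_succ']
    change (adjoint (cauchyDual T) ^ n) (adjoint (cauchyDual T) (T ((T ^ n) x))) = x
    rw [hT.adjoint_cauchyDual_apply_apply, ih]

/-- For `z = (T*T)⁻¹y`, one has `‖Tz‖² = ⟨z, y⟩ ≤ ‖z‖‖y‖ ≤ ‖Tz‖‖y‖`. -/
theorem norm_cauchyDual_le_one (hT : IsTwoIsometry T) : ‖cauchyDual T‖ ≤ 1 := by
  refine opNorm_le_bound _ zero_le_one fun y => ?_
  rw [one_mul]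
  set z := Ring.inverse (adjoint T * T) y with hz
  change ‖T z‖ ≤ ‖y‖
  have h1 := inner_adjoint_apply_self T z
  rw [hz, hT.gram_inverse_apply, ← hz] at h1
  have h2 := norm_inner_le_norm (𝕜 := ℂ) z y
  rw [h1, Complex.norm_real, Real.norm_of_nonneg (sq_nonneg _)] at h2
  have h3 := hT.norm_le_norm_apply z
  by_contra! h
  nlinarith [norm_nonneg z, norm_nonneg y]

theorem norm_adjoint_cauchyDual_le (hT : IsTwoIsometry T) (x : H) :
    ‖adjoint (cauchyDual T) x‖ ≤ ‖x‖ := by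
  have := (adjoint (cauchyDual T)).le_of_opNorm_le
    ((LinearIsometryEquiv.norm_map adjoint _).trans_le hT.norm_cauchyDual_le_one) x
  rwa [one_mul] at this

theorem norm_adjoint_cauchyDual_pow_le (hT : IsTwoIsometry T) (n : ℕ) (x : H) :
    ‖(adjoint (cauchyDual T) ^ n) x‖ ≤ ‖x‖ := by
  induction n generalizing x with
  | zero => simp
  | succ n ih =>
    rw [pow_succ]
    exact (ih _).trans (hT.norm_adjoint_cauchyDual_le x)

theorem norm_cauchyDual_pow_le (hT : IsTwoIsometry T) (n : ℕ) (x : H) :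
    ‖(cauchyDual T ^ n) x‖ ≤ ‖x‖ := by
  induction n generalizing x with
  | zero => simp
  | succ n ih =>
    rw [pow_succ]
    refine (ih _).trans ?_
    have := (cauchyDual T).le_of_opNorm_le hT.norm_cauchyDual_le_one x
    rwa [one_mul] at this

/-- `T T'*` is the orthogonal projection onto the range of `T`. -/
theorem norm_apply_adjoint_cauchyDual_le (hT : IsTwoIsometry T) (x : H) :
    ‖T (adjoint (cauchyDual T) x)‖ ≤ ‖x‖ := by
  have h1 := inner_adjoint_apply_self T (adjoint (cauchyDual T) x)
  rw [hT.adjoint_cauchyDual_apply, hT.gram_inverse_apply, ← hT.adjoint_cauchyDual_apply,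
    adjoint_inner_right] at h1
  have h2 := norm_inner_le_norm (𝕜 := ℂ) (T (adjoint (cauchyDual T) x)) x
  rw [h1, Complex.norm_real, Real.norm_of_nonneg (sq_nonneg _)] at h2
  by_contra! h
  nlinarith [norm_nonneg x]

/-! ### The unitary part -/

theorem injective (hT : IsTwoIsometry T) : Function.Injective T := fun x y h => by
  rw [← hT.adjoint_cauchyDual_apply_apply x, h, hT.adjoint_cauchyDual_apply_apply]

theorem isClosed_range_pow (hT : IsTwoIsometry T) (n : ℕ) :
    IsClosed ((T ^ n).range : Set H) := by
  have h : AntilipschitzWith 1 (T ^ n) := AddMonoidHomClass.antilipschitz_of_bound _ fun x => by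
    simpa using hT.norm_le_norm_pow n x
  exact h.isClosed_range (T ^ n).uniformContinuous

/-- The intersection is mapped onto itself by `T`; it is shown to be a reducing subspace on which
`T` is unitary. -/
theorem iInf_range_pow_eq_bot (hT : IsTwoIsometry T) (hc : IsCompletelyNonUnitary T) :
    ⨅ n : ℕ, (T ^ n).range = ⊥ := by
  set L : Submodule ℂ H := ⨅ n : ℕ, (T ^ n).range with hL
  have hmem : ∀ {x}, x ∈ L ↔ ∀ n : ℕ, ∃ w, (T ^ n) w = x := fun {x} => by
    rw [hL, Submodule.mem_iInf]
    rfl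
  have hclosed : IsClosed (L : Set H) := by
    rw [hL, Submodule.coe_iInf]
    exact isClosed_iInter fun n => hT.isClosed_range_pow n
  have hinv : ∀ x ∈ L, T x ∈ L := fun x hx => hmem.2 fun n => by
    obtain ⟨w, rfl⟩ := hmem.1 hx n
    exact ⟨T w, congrArg (fun S : H →L[ℂ] H => S w) ((pow_succ T n).symm.trans (pow_succ' T n))⟩
  have hsurj : ∀ x ∈ L, ∃ y ∈ L, T y = x := fun x hx => by
    have h : ∀ n : ℕ, ∃ w, T ((T ^ n) w) = x := fun n => by
      obtain ⟨w, hw⟩ := hmem.1 hx (n + 1)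
      rw [pow_succ'] at hw
      exact ⟨w, hw⟩
    obtain ⟨y, hy⟩ := h 0
    refine ⟨y, hmem.2 fun n => ?_, hy⟩
    obtain ⟨w, hw⟩ := h n
    exact ⟨w, hT.injective (hw.trans hy.symm)⟩
  -- If `x = Tⁿw`, the slope `δ = ‖Tx‖² - ‖x‖²` is the same at `w`, so `‖x‖² = ‖w‖² + nδ ≥ nδ` for
  -- every `n`, which forces `δ ≤ 0`.
  have hnorm : ∀ x ∈ L, ‖T x‖ = ‖x‖ := fun x hx => by
    refine le_antisymm (le_of_sq_le_sq ?_ (norm_nonneg _)) (hT.norm_le_norm_apply x)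
    by_contra! h
    rw [← sub_pos] at h
    obtain ⟨n, hn⟩ := exists_nat_gt (‖x‖ ^ 2 / (‖T x‖ ^ 2 - ‖x‖ ^ 2))
    rw [div_lt_iff₀ h] at hn
    obtain ⟨w, rfl⟩ := hmem.1 hx n
    have h1 := hT.norm_sq_pow n w
    have h2 := hT.norm_sq_pow (n + 1) w
    rw [pow_succ' T] at h2
    change ‖T ((T ^ n) w)‖ ^ 2 = _ at h2
    rw [Nat.cast_succ] at h2
    nlinarith [sq_nonneg ‖w‖]
  refine hc L hclosed ⟨hinv, fun y hy z hz => ?_⟩ ?_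
  -- `T*T` fixes each `w ∈ L`, so `⟨Tw, Ty⟩ = ⟨w, y⟩ = 0` for `y ⟂ L`.
  · obtain ⟨w, hw, rfl⟩ := hsurj z hz
    rw [← adjoint_inner_left, hT.adjoint_apply_eq_of_norm_eq (hnorm w hw)]
    exact hy w hw
  · let V : L →ₗᵢ[ℂ] L := ⟨(T : H →ₗ[ℂ] H).restrict hinv, fun x => hnorm x x.2⟩
    refine ⟨LinearIsometryEquiv.ofSurjective V fun x => ?_, fun x => rfl⟩
    obtain ⟨y, hy, hyx⟩ := hsurj x x.2
    exact ⟨⟨y, hy⟩, Subtype.ext hyx⟩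

theorem ker_adjoint_pow_dense (hT : IsTwoIsometry T) (hc : IsCompletelyNonUnitary T) (x : H)
    {ε : ℝ} (hε : 0 < ε) : ∃ N, ∃ y, ‖x - y‖ < ε ∧ ∀ n, N ≤ n → ∀ z, inner ℂ y ((T ^ n) z) = 0 := by
  have hmono : Monotone fun n : ℕ => ((T ^ n).range)ᗮ := fun m n hmn => by
    refine Submodule.orthogonal_le ?_
    rintro _ ⟨w, rfl⟩
    refine ⟨(T ^ (n - m)) w, ?_⟩
    change (T ^ m * T ^ (n - m)) w = (T ^ n) w
    rw [← pow_add, Nat.add_sub_cancel' hmn]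
  have hbot : ∀ z, (∀ n : ℕ, ∀ y ∈ ((T ^ n).range)ᗮ, inner ℂ y z = 0) → z = 0 := by
    intro z hz
    rw [← Submodule.mem_bot ℂ, ← hT.iInf_range_pow_eq_bot hc, Submodule.mem_iInf]
    intro n
    have h1 : z ∈ ((T ^ n).range)ᗮᗮ := fun y hy => hz n y hy
    rwa [Submodule.orthogonal_orthogonal_eq_closure,
      (hT.isClosed_range_pow n).submodule_topologicalClosure_eq] at h1
  obtain ⟨N, y, hy, hxy⟩ := exists_norm_sub_lt_of_iSup_orthogonal_eq_bot hmono hbot x hε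
  exact ⟨N, y, hxy, fun n hn z => (Submodule.mem_orthogonal' _ _).1 (hmono hn hy) _ ⟨z, rfl⟩⟩

/-! ### Density of the kernels of `T'*ⁿ` -/

/-- Put `aₙ = ‖T'*ⁿx‖²`. The growth formula and contractivity of `T T'*` bound the square at `n + 1`
by `‖x‖² + (n + 1)(aₙ - aₙ₊₁)`. The decrements `aₙ - aₙ₊₁ ≥ 0` are summable, so they cannot
eventually exceed `1/(n + 1)`. -/
theorem frequently_norm_pow_apply_adjoint_pow_le (hT : IsTwoIsometry T) (x : H) :
    ∃ᶠ n in atTop, ‖(T ^ n) ((adjoint (cauchyDual T) ^ n) x)‖ ^ 2 ≤ ‖x‖ ^ 2 + 1 := by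
  intro h
  set a : ℕ → ℝ := fun n => ‖(adjoint (cauchyDual T) ^ n) x‖ ^ 2 with ha
  have hsucc : ∀ n, (adjoint (cauchyDual T) ^ (n + 1)) x =
      adjoint (cauchyDual T) ((adjoint (cauchyDual T) ^ n) x) := fun n => by
    rw [pow_succ']
    rfl
  have hanti : ∀ n, 0 ≤ a n - a (n + 1) := fun n => by
    simp only [ha, hsucc]
    exact sub_nonneg.2 (pow_le_pow_left₀ (norm_nonneg _) (hT.norm_adjoint_cauchyDual_le _) 2)
  have hsum : Summable fun n => a n - a (n + 1) := by
    refine summable_of_sum_range_le (c := a 0) hanti fun n => ?_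
    rw [Finset.sum_range_sub']
    exact sub_le_self _ (sq_nonneg _)
  have hbound : ∀ n, ‖(T ^ (n + 1)) ((adjoint (cauchyDual T) ^ (n + 1)) x)‖ ^ 2 ≤
      ‖x‖ ^ 2 + ((n + 1 : ℕ) : ℝ) * (a n - a (n + 1)) := fun n => by
    rw [hT.norm_sq_pow]
    refine add_le_add ?_ (mul_le_mul_of_nonneg_left ?_ (Nat.cast_nonneg _))
    · exact pow_le_pow_left₀ (norm_nonneg _) (hT.norm_adjoint_cauchyDual_pow_le _ _) 2
    · refine sub_le_sub_right ?_ _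
      rw [hsucc]
      exact pow_le_pow_left₀ (norm_nonneg _) (hT.norm_apply_adjoint_cauchyDual_le _) 2
  obtain ⟨N, hN⟩ := eventually_atTop.1 h
  refine Real.not_summable_one_div_natCast
    ((_root_.summable_nat_add_iff (N + 1)).1 (Summable.of_nonneg_of_le (fun n => by positivity)
      (fun n => ?_) ((_root_.summable_nat_add_iff N).2 hsum)))
  have h1 := hN (n + N + 1) (by omega)
  have h2 := hbound (n + N)
  rw [← add_assoc, div_le_iff₀' (by positivity)]
  linarith

/-- Pick `y` within `ε` of `x` and orthogonal to `ran Tⁿ` for large `n`. Along the bounded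
subsequence `‖x‖² = ⟨vₙ, x - y⟩ ≤ (‖x‖ + 1)ε`. -/
theorem eq_zero_of_orthogonal_ker (hT : IsTwoIsometry T) (hc : IsCompletelyNonUnitary T) {x : H}
    (hx : ∀ n : ℕ, ∀ y, (adjoint (cauchyDual T) ^ n) y = 0 → inner ℂ y x = 0) : x = 0 := by
  have h1 : ∀ n : ℕ, inner ℂ ((T ^ n) ((adjoint (cauchyDual T) ^ n) x)) x = inner ℂ x x := by
    intro n
    have := hx n (x - (T ^ n) ((adjoint (cauchyDual T) ^ n) x)) (by
      rw [map_sub, hT.adjoint_cauchyDual_pow_apply_pow, sub_self])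
    rw [inner_sub_left] at this
    exact (sub_eq_zero.1 this).symm
  have h2 : ∀ ε : ℝ, 0 < ε → ‖x‖ ^ 2 ≤ (‖x‖ + 1) * ε := by
    intro ε hε
    obtain ⟨N, y, hxy, hy⟩ := hT.ker_adjoint_pow_dense hc x hε
    obtain ⟨n, hn, hnN⟩ := ((hT.frequently_norm_pow_apply_adjoint_pow_le x).and_eventually
      (eventually_ge_atTop N)).exists
    set v := (T ^ n) ((adjoint (cauchyDual T) ^ n) x) with hv
    have h3 : inner ℂ v (x - y) = ((‖x‖ ^ 2 : ℝ) : ℂ) := by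
      rw [inner_sub_right, h1, ← inner_conj_symm v y, hy n hnN, map_zero, sub_zero,
        inner_self_eq_ofReal]
    have h4 := norm_inner_le_norm (𝕜 := ℂ) v (x - y)
    rw [h3, Complex.norm_real, Real.norm_of_nonneg (sq_nonneg _)] at h4
    have h5 : ‖v‖ ≤ ‖x‖ + 1 := by
      refine le_of_sq_le_sq (hn.trans ?_) (by positivity)
      nlinarith [norm_nonneg x]
    exact h4.trans (mul_le_mul h5 hxy.le (norm_nonneg _) (by positivity))
  have h6 : ‖x‖ ^ 2 ≤ 0 := by
    refine le_of_forall_pos_le_add fun ε hε => ?_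
    have := h2 (ε / (‖x‖ + 1)) (by positivity)
    rwa [mul_div_cancel₀ _ (by positivity), ← zero_add ε] at this
  exact norm_eq_zero.1 (pow_eq_zero_iff two_ne_zero |>.1 (le_antisymm h6 (sq_nonneg _)))

theorem monotone_ker_adjoint_cauchyDual_pow :
    Monotone fun n : ℕ => (adjoint (cauchyDual T) ^ n).ker := fun m n hmn x hx => by
  change (adjoint (cauchyDual T) ^ m) x = 0 at hx
  change (adjoint (cauchyDual T) ^ n) x = 0
  rw [← Nat.sub_add_cancel hmn, pow_add]
  change (adjoint (cauchyDual T) ^ (n - m)) ((adjoint (cauchyDual T) ^ m) x) = 0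
  rw [hx, map_zero]

/-- The Cauchy dual of a 2-isometry is of class `C_{·0}` iff the 2-isometry is completely
non-unitary. -/
theorem isClassCDotZero_cauchyDual_iff (hT : IsTwoIsometry T) :
    IsClassCDotZero (cauchyDual T) ↔ IsCompletelyNonUnitary T := by
  refine ⟨fun h L _ _ ⟨U, hU⟩ => ?_, fun hc => ⟨hT.norm_cauchyDual_le_one, fun f => ?_⟩⟩
  · rw [Submodule.eq_bot_iff]
    intro x hx
    -- `w` is `U⁻ⁿx`; it equals `T'*ⁿx`, whose norm therefore stays `‖x‖`.
    have h1 : ∀ n : ℕ, ∃ w : L, (T ^ n) (w : H) = x ∧ ‖(w : H)‖ = ‖x‖ := by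
      intro n
      induction n with
      | zero => exact ⟨⟨x, hx⟩, rfl, rfl⟩
      | succ n ih =>
        obtain ⟨w, hw, hwn⟩ := ih
        refine ⟨U.symm w, ?_, ?_⟩
        · rw [pow_succ]
          change (T ^ n) (T (U.symm w)) = x
          rw [← hU, U.apply_symm_apply, hw]
        · rw [← hwn]
          exact U.symm.norm_map w
    have h2 : Tendsto (fun _ : ℕ => ‖x‖) atTop (𝓝 0) := by
      have := (h.2 x).norm
      rw [norm_zero] at this
      refine this.congr fun n => ?_
      obtain ⟨w, hw, hwn⟩ := h1 n
      rw [← hwn, ← hw, hT.adjoint_cauchyDual_pow_apply_pow]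
    exact norm_eq_zero.1 (tendsto_nhds_unique tendsto_const_nhds h2)
  · rw [Metric.tendsto_atTop]
    intro ε hε
    obtain ⟨N, y, hy, hxy⟩ := exists_norm_sub_lt_of_iSup_orthogonal_eq_bot
      (monotone_ker_adjoint_cauchyDual_pow (T := T))
      (fun z hz => hT.eq_zero_of_orthogonal_ker hc fun n y hy => hz n y hy) f hε
    refine ⟨N, fun n hn => ?_⟩
    have hy0 : (adjoint (cauchyDual T) ^ n) y = 0 := monotone_ker_adjoint_cauchyDual_pow hn hy
    rw [dist_zero_right, ← sub_zero ((adjoint (cauchyDual T) ^ n) f), ← hy0, ← map_sub]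
    exact (hT.norm_adjoint_cauchyDual_pow_le _ _).trans_lt hxy

theorem isCompletelyNonUnitary_of_fixed_eq_zero (hT : IsTwoIsometry T)
    (h : ∀ x, adjoint T (T x) = x → x = 0) : IsCompletelyNonUnitary T := by
  rintro L - - ⟨U, hU⟩
  rw [Submodule.eq_bot_iff]
  refine fun x hx => h x (hT.adjoint_apply_eq_of_norm_eq ?_)
  have := hU ⟨x, hx⟩
  rw [← this]
  exact U.norm_map ⟨x, hx⟩

/-! ### The kernel condition -/

/-- By selfadjointness the kernel condition makes `T*T` preserve the range of `T`. So `T*T T x` is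
fixed by the projection `T (T*T)⁻¹T*`, and the 2-isometry identity evaluates the result. -/
theorem gram_apply_apply (hT : IsTwoIsometry T) (hk : KernelCondition T) (x : H) :
    adjoint T (T (T x)) = (2 : ℂ) • T x - cauchyDual T x := by
  set B := Ring.inverse (adjoint T * T) with hB
  set y := adjoint T (T (T x)) with hy
  have h1 : adjoint T (y - T (B (adjoint T y))) = 0 := by
    rw [map_sub, hT.gram_inverse_apply, sub_self]
  have h2 : y - T (B (adjoint T y)) = 0 := by
    set v := y - T (B (adjoint T y)) with hv
    have h3 : inner ℂ v y = 0 := by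
      rw [hy, adjoint_inner_right, ← adjoint_inner_left, ← adjoint_inner_left, hk v h1,
        inner_zero_left]
    have h4 : inner ℂ v (T (B (adjoint T y))) = 0 := by
      rw [← adjoint_inner_left, h1, inner_zero_left]
    have h5 : inner ℂ v v = 0 := by
      conv_lhs => rw [hv, inner_sub_right, h3, h4, sub_zero]
    exact inner_self_eq_zero.1 h5
  rw [sub_eq_zero.1 h2, hy, hT.apply_adjoint_sq, map_sub, map_smul, hT.inverse_gram_apply, map_sub,
    map_smul]
  rfl

theorem cauchyDual_apply_gram (hT : IsTwoIsometry T) (x : H) :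
    cauchyDual T (adjoint T (T x)) = T x :=
  congrArg T (hT.inverse_gram_apply x)

/-- Induction on `T'(1 + (n + 1)D) = (1 + nD)T`, followed by `T'*T = 1`. -/
theorem adjoint_pow_cauchyDual_pow (hT : IsTwoIsometry T) (hk : KernelCondition T) (n : ℕ) (x : H) :
    (adjoint (cauchyDual T) ^ n) ((cauchyDual T ^ n) (x + (n : ℂ) • (adjoint T (T x) - x))) = x := by
  induction n generalizing x with
  | zero => simp
  | succ n ih =>
    have h : cauchyDual T (x + ((n + 1 : ℕ) : ℂ) • (adjoint T (T x) - x)) =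
        T x + (n : ℂ) • (adjoint T (T (T x)) - T x) := by
      rw [hT.gram_apply_apply hk, map_add, map_smul, map_sub, hT.cauchyDual_apply_gram]
      push_cast
      module
    rw [pow_succ' (adjoint _), pow_succ (cauchyDual T)]
    change adjoint (cauchyDual T) ((adjoint (cauchyDual T) ^ n) ((cauchyDual T ^ n)
      (cauchyDual T (x + ((n + 1 : ℕ) : ℂ) • (adjoint T (T x) - x))))) = x
    rw [h, ih, hT.adjoint_cauchyDual_apply_apply]

theorem inner_cauchyDual_pow (n : ℕ) (x y : H) :
    inner ℂ ((cauchyDual T ^ n) x) ((cauchyDual T ^ n) y) =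
      inner ℂ x ((adjoint (cauchyDual T) ^ n) ((cauchyDual T ^ n) y)) := by
  rw [← adjoint_inner_right, ← star_eq_adjoint, ← star_eq_adjoint, star_pow]

/-- On `ker D` the powers of `T'` are isometric. For `d = Dg` the identity gives `n T'*ⁿT'ⁿd = g -
T'*ⁿT'ⁿg`, hence `n‖T'ⁿd‖² ≤ 2‖d‖‖g‖`. As `D` is selfadjoint, `ker D = 0` makes such `d` dense. -/
theorem isClassCZeroDot_cauchyDual_iff (hT : IsTwoIsometry T) (hk : KernelCondition T) :
    IsClassCZeroDot (cauchyDual T) ↔ ∀ x, adjoint T (T x) = x → x = 0 := by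
  refine ⟨fun h x hx => ?_, fun h => ⟨hT.norm_cauchyDual_le_one, ?_⟩⟩
  · have h2 : Tendsto (fun _ : ℕ => ‖x‖ ^ 2) atTop (𝓝 0) := by
      have := (h.2 x).norm.pow 2
      rw [norm_zero, zero_pow two_ne_zero] at this
      refine this.congr fun n => ?_
      have h3 := hT.adjoint_pow_cauchyDual_pow hk n x
      rw [hx, sub_self, smul_zero, add_zero] at h3
      have h4 := inner_cauchyDual_pow (T := T) n x x
      rw [h3, inner_self_eq_ofReal, inner_self_eq_ofReal] at h4
      exact Complex.ofReal_inj.1 h4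
    exact norm_eq_zero.1 ((pow_eq_zero_iff two_ne_zero).1
      (tendsto_nhds_unique tendsto_const_nhds h2))
  · have hrange : ∀ g, Tendsto (fun n : ℕ => (cauchyDual T ^ n) (adjoint T (T g) - g)) atTop
        (𝓝 0) := by
      intro g
      set d := adjoint T (T g) - g with hd
      have h1 : ∀ n : ℕ, n * ‖(cauchyDual T ^ n) d‖ ^ 2 ≤ ‖d‖ * (2 * ‖g‖) := by
        intro n
        have h2 := hT.adjoint_pow_cauchyDual_pow hk n g
        rw [← hd, map_add, map_add, map_smul, map_smul, ← eq_sub_iff_add_eq'] at h2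
        have h3 := inner_cauchyDual_pow (T := T) n d d
        have h4 := congrArg (fun z => (n : ℂ) * z) h3
        simp only [← inner_smul_right (x := d)] at h4
        rw [h2, inner_self_eq_ofReal] at h4
        have h5 := norm_inner_le_norm (𝕜 := ℂ) d
          (g - (adjoint (cauchyDual T) ^ n) ((cauchyDual T ^ n) g))
        rw [← h4, norm_mul, Complex.norm_natCast, Complex.norm_real,
          Real.norm_of_nonneg (sq_nonneg _)] at h5
        refine h5.trans (mul_le_mul_of_nonneg_left ((norm_sub_le _ _).trans ?_) (norm_nonneg _))
        linarith [(hT.norm_adjoint_cauchyDual_pow_le n ((cauchyDual T ^ n) g)).trans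
          (hT.norm_cauchyDual_pow_le n g)]
      have h6 : Tendsto (fun n : ℕ => ‖(cauchyDual T ^ n) d‖ ^ 2) atTop (𝓝 0) := by
        refine tendsto_of_tendsto_of_tendsto_of_le_of_le' tendsto_const_nhds
          (tendsto_const_div_atTop_nhds_zero_nat (‖d‖ * (2 * ‖g‖)))
          (Eventually.of_forall fun n => sq_nonneg _) ?_
        filter_upwards [eventually_gt_atTop 0] with n hn
        rw [le_div_iff₀' (Nat.cast_pos.2 hn)]
        exact h1 n
      rw [tendsto_zero_iff_norm_tendsto_zero]
      have := h6.sqrt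
      simpa only [Real.sqrt_sq (norm_nonneg _), Real.sqrt_zero] using this
    intro f
    rw [Metric.tendsto_atTop]
    intro ε hε
    -- The density lemma is applied to a constant family of subspaces.
    obtain ⟨-, y, ⟨g, rfl⟩, hxy⟩ := exists_norm_sub_lt_of_iSup_orthogonal_eq_bot
      (K := fun _ => (adjoint T * T - 1).range) monotone_const (fun z hz => by
        refine h z (sub_eq_zero.1 (ext_inner_left ℂ fun w => ?_))
        rw [inner_zero_right, inner_sub_right, adjoint_inner_right]
        have := hz 0 _ ⟨w, rfl⟩
        change inner ℂ (adjoint T (T w) - w) z = 0 at this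
        rwa [inner_sub_left, adjoint_inner_left] at this) f (half_pos hε)
    obtain ⟨N, hN⟩ := Metric.tendsto_atTop.1 (hrange g) (ε / 2) (half_pos hε)
    refine ⟨N, fun n hn => ?_⟩
    have h1 := hN n hn
    change ‖f - (adjoint T (T g) - g)‖ < ε / 2 at hxy
    set d := adjoint T (T g) - g
    rw [dist_zero_right] at h1 ⊢
    have h2 : (cauchyDual T ^ n) f = (cauchyDual T ^ n) (f - d) + (cauchyDual T ^ n) d := by
      rw [map_sub, sub_add_cancel]
    rw [h2]
    refine (norm_add_le _ _).trans_lt ?_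
    linarith [hT.norm_cauchyDual_pow_le n (f - d)]

end IsTwoIsometry

end

/-! ### The atom at `1` -/

namespace OpSpectralMeasure

variable {X : Type*} [MeasurableSpace X] {M : Type*} [NormedAddCommGroup M]
  [InnerProductSpace ℂ M] [CompleteSpace M] (E : OpSpectralMeasure X M)

theorem scalar_univ (x : M) : E.scalar x Set.univ = ENNReal.ofReal (‖x‖ ^ 2) := by
  rw [scalar_apply _ _ MeasurableSet.univ, E.univ, one_apply_eq_self, inner_self_eq_ofReal,
    Complex.ofReal_re]

instance (x : M) : IsFiniteMeasure (E.scalar x) :=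
  ⟨by rw [scalar_univ]; exact ENNReal.ofReal_lt_top⟩

theorem integral_one (x : M) : ∫ _, (1 : ℝ) ∂(E.scalar x) = ‖x‖ ^ 2 := by
  rw [integral_const, measureReal_def, scalar_univ, ENNReal.toReal_ofReal (sq_nonneg _), smul_eq_mul,
    mul_one]

theorem eq_zero_of_scalar_eq_zero {x : M} (h : E.scalar x = 0) : x = 0 := by
  have := E.integral_one x
  rw [h, integral_zero_measure] at this
  exact norm_eq_zero.1 ((pow_eq_zero_iff two_ne_zero).1 this.symm)

theorem ae_mem_scalar_proj {A : Set X} (hA : MeasurableSet A) (x : M) :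
    ∀ᵐ t ∂(E.scalar (E.proj A x)), t ∈ A := by
  have h : E.proj Aᶜ (E.proj A x) = 0 := by
    have := E.inter Aᶜ A hA.compl hA
    rw [Set.compl_inter_self, E.empty] at this
    exact (congrArg (fun S : M →L[ℂ] M => S x) this).symm
  rw [ae_iff]
  change E.scalar _ Aᶜ = 0
  rw [scalar_apply _ _ hA.compl, h, inner_zero_right, Complex.zero_re, ENNReal.ofReal_zero]

theorem eq_zero_of_ae_mem {A : Set X} (hA : MeasurableSet A) (h0 : E.proj A = 0) {x : M}
    (h : ∀ᵐ t ∂(E.scalar x), t ∈ A) : x = 0 := by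
  refine E.eq_zero_of_scalar_eq_zero (Measure.measure_univ_eq_zero.1 ?_)
  rw [← Set.union_compl_self A]
  refine measure_union_null ?_ h
  rw [scalar_apply _ _ hA, h0, zero_apply, inner_zero_right, Complex.zero_re, ENNReal.ofReal_zero]

variable {E} {f : X → ℝ} {S : M →L[ℂ] M}

theorem HasIntegral.inner_eq_norm_sq (h : E.HasIntegral f S) {x : M}
    (hx : ∀ᵐ t ∂(E.scalar x), f t = 1) : inner ℂ x (S x) = ((‖x‖ ^ 2 : ℝ) : ℂ) := by
  rw [(h x).2, integral_congr_ae hx, integral_one]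

theorem HasIntegral.norm_sq_le (h : E.HasIntegral f S) {x : M}
    (hx : ∀ᵐ t ∂(E.scalar x), 1 ≤ f t) : ‖x‖ ^ 2 ≤ (inner ℂ x (S x)).re := by
  rw [(h x).2, Complex.ofReal_re, ← E.integral_one]
  exact integral_mono_ae (integrable_const _) (h x).1 hx

theorem HasIntegral.ae_eq_one (h : E.HasIntegral f S) {x : M}
    (hx : ∀ᵐ t ∂(E.scalar x), 1 ≤ f t) (hle : (inner ℂ x (S x)).re ≤ ‖x‖ ^ 2) :
    ∀ᵐ t ∂(E.scalar x), f t = 1 := by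
  rw [(h x).2, Complex.ofReal_re, ← E.integral_one] at hle
  have h1 : ∫ t, (f t - 1) ∂(E.scalar x) = 0 := by
    rw [integral_sub (h x).1 (integrable_const _)]
    exact le_antisymm (sub_nonpos.2 hle)
      (sub_nonneg.2 (integral_mono_ae (integrable_const _) (h x).1 hx))
  have h2 := (integral_eq_zero_iff_of_nonneg_ae (hx.mono fun t ht => sub_nonneg.2 ht)
    ((h x).1.sub (integrable_const _))).1 h1
  exact h2.mono fun t ht => sub_eq_zero.1 ht

theorem HasIntegral.norm_le_norm_apply (h : E.HasIntegral f S) {x : M}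
    (hx : ∀ᵐ t ∂(E.scalar x), 1 ≤ f t) : ‖x‖ ≤ ‖S x‖ := by
  have h1 := (h.norm_sq_le hx).trans ((Complex.re_le_norm _).trans (norm_inner_le_norm x (S x)))
  by_contra! hlt
  nlinarith [norm_nonneg (S x)]

theorem HasIntegral.sub_one_nonneg (h : E.HasIntegral f S) (hf : ∀ t, 1 ≤ f t) : 0 ≤ S - 1 := by
  rw [nonneg_iff_isPositive, isPositive_iff_complex]
  intro x
  have h1 : inner ℂ ((S - 1) x) x = (((∫ t, f t ∂(E.scalar x)) - ‖x‖ ^ 2 : ℝ) : ℂ) := by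
    rw [← inner_conj_symm, sub_apply, one_apply_eq_self, inner_sub_right, (h x).2,
      inner_self_eq_ofReal, ← Complex.ofReal_sub, Complex.conj_ofReal]
  have h2 := h.norm_sq_le (x := x) (Eventually.of_forall hf)
  rw [(h x).2, Complex.ofReal_re] at h2
  rw [h1, RCLike.re_to_complex, Complex.ofReal_re]
  exact ⟨rfl, sub_nonneg.2 h2⟩

end OpSpectralMeasure

section

variable {H : Type*} [NormedAddCommGroup H] [InnerProductSpace ℂ H] [CompleteSpace H]
  {T : H →L[ℂ] H}

/-- A fixed vector of `T*T` has scalar measure carried by `[1, ∞)` with mean 1, hence by `{1}`.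
Conversely `T` preserves the norm on the range of `G({1})`. -/
theorem IsTwoIsometry.proj_one_eq_zero_iff (hT : IsTwoIsometry T) {G : OpSpectralMeasure ℝ H}
    (hG : IsSpectralMeasureOf G (adjoint T * T)) :
    G.proj {1} = 0 ↔ ∀ x, adjoint T (T x) = x → x = 0 := by
  have hinner : ∀ x, inner ℂ x ((adjoint T * T) x) = ((‖T x‖ ^ 2 : ℝ) : ℂ) :=
    inner_adjoint_apply_self T
  refine ⟨fun h x hx => ?_, fun h => ?_⟩
  -- `G` lives on the whole line, so `T*T ≥ 1` is used first to exclude mass below 1.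
  · have h1 : ∀ v : H, (∀ᵐ t ∂(G.scalar v), t ∈ Set.Iio (1 : ℝ)) → v = 0 := by
      intro v hv
      have h2 : ∫ t, (1 - t) ∂(G.scalar v) ≤ 0 := by
        rw [integral_sub (integrable_const _) (hG.2 v).1, G.integral_one, sub_nonpos]
        have := (hG.2 v).2
        rw [hinner, Complex.ofReal_inj] at this
        rw [← this]
        exact pow_le_pow_left₀ (norm_nonneg _) (hT.norm_le_norm_apply v) 2
      have h3 : 0 ≤ᵐ[G.scalar v] fun t => 1 - t := hv.mono fun t ht => sub_nonneg.2 (le_of_lt ht)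
      have h4 := (integral_eq_zero_iff_of_nonneg_ae h3 ((integrable_const _).sub (hG.2 v).1)).1
        (le_antisymm h2 (integral_nonneg_of_ae h3))
      refine G.eq_zero_of_scalar_eq_zero (ae_eq_bot.1 (eventually_false_iff_eq_bot.1 ?_))
      filter_upwards [hv, h4] with t ht ht'
      exact (sub_pos.2 (Set.mem_Iio.1 ht)).ne' ht'
    have h5 : ∀ᵐ t ∂(G.scalar x), 1 ≤ t := by
      rw [ae_iff]
      have : {t : ℝ | ¬ 1 ≤ t} = Set.Iio 1 := by ext; simp
      rw [this, OpSpectralMeasure.scalar_apply _ _ measurableSet_Iio,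
        h1 _ (G.ae_mem_scalar_proj measurableSet_Iio x)]
      simp
    refine G.eq_zero_of_ae_mem (measurableSet_singleton _) h (hG.2.ae_eq_one h5 ?_)
    change (inner ℂ x (adjoint T (T x))).re ≤ _
    rw [hx, inner_self_eq_ofReal, Complex.ofReal_re]
  · refine ContinuousLinearMap.ext fun x => h _ (hT.adjoint_apply_eq_of_norm_eq ?_)
    have h1 := hG.2.inner_eq_norm_sq (G.ae_mem_scalar_proj (measurableSet_singleton 1) x)
    rw [hinner, Complex.ofReal_inj] at h1
    exact (sq_eq_sq₀ (norm_nonneg _) (norm_nonneg _)).1 h1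

theorem one_le_xi (n : ℕ) (x : Set.Ici (1 : ℝ)) : 1 ≤ xi n x := by
  have hx : (0 : ℝ) ≤ (x : ℝ) ^ 2 - 1 := sub_nonneg.2 (one_le_pow₀ x.2)
  rw [xi, Real.one_le_sqrt, one_le_div (by positivity)]
  linarith

theorem xi_eq_one_iff (n : ℕ) (x : Set.Ici (1 : ℝ)) : xi n x = 1 ↔ x = oneIci := by
  have hx : (0 : ℝ) ≤ (x : ℝ) ^ 2 - 1 := sub_nonneg.2 (one_le_pow₀ x.2)
  rw [xi, Real.sqrt_eq_one, div_eq_one_iff_eq (by positivity)]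
  refine ⟨fun h => Subtype.ext ?_, fun h => by simp [h, oneIci]⟩
  have h1 : (x : ℝ) ^ 2 = 1 ^ 2 := by linarith
  exact (sq_eq_sq₀ (zero_le_one.trans x.2) zero_le_one).1 h1

/-- The nonnegative terms `‖wₙhₙ‖² - ‖hₙ‖²` sum to `‖Wh‖² - ‖h‖² = 0`. -/
theorem IsOpWeightedShift.norm_eq_of_forall {M : Type*} [NormedAddCommGroup M]
    [InnerProductSpace ℂ M] {W : lp (fun _ : ℕ => M) 2 →L[ℂ] lp (fun _ : ℕ => M) 2}
    {w : ℕ → M →L[ℂ] M} (hW : IsOpWeightedShift W w) (hw : ∀ n x, ‖x‖ ≤ ‖w n x‖)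
    {h : lp (fun _ : ℕ => M) 2} (hh : ‖W h‖ = ‖h‖) (n : ℕ) : ‖w n (h n)‖ = ‖h n‖ := by
  have hs : ∀ k : lp (fun _ : ℕ => M) 2, HasSum (fun n => ‖k n‖ ^ 2) (‖k‖ ^ 2) := fun k => by
    have := lp.hasSum_norm (p := 2) (by norm_num) k
    simpa using this
  have h1 := (hasSum_nat_add_iff' 1).2 (hs (W h))
  simp only [Finset.range_one, Finset.sum_singleton, (hW h).1, (hW h).2, norm_zero, hh] at h1
  have h2 := h1.sub (hs h)
  rw [zero_pow two_ne_zero, sub_zero, sub_self] at h2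
  have h3 := (hasSum_zero_iff_of_nonneg fun n => sub_nonneg.2
    (pow_le_pow_left₀ (norm_nonneg _) (hw n (h n)) 2)).1 h2
  exact (sq_eq_sq₀ (norm_nonneg _) (norm_nonneg _)).1 (sub_eq_zero.1 (congrFun h3 n))

/-- `ξₙ ≥ 1` with equality only at 1. So if `W` preserves the norm of `h`, the scalar measure of
each coordinate sits at 1. Conversely, a vector in the range of `E({1})` placed in slot 0 is moved
to slot 1 unchanged. -/
theorem IsTwoIsometry.proj_oneIci_eq_zero_iff (hT : IsTwoIsometry T) {M : Type*}
    [NormedAddCommGroup M] [InnerProductSpace ℂ M] [CompleteSpace M]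
    {E : OpSpectralMeasure (Set.Ici (1 : ℝ)) M} (hE : IsModelMeasure E T) :
    E.proj {oneIci} = 0 ↔ ∀ x, adjoint T (T x) = x → x = 0 := by
  obtain ⟨-, w, W, U, hw, hW, hU⟩ := hE
  have hnorm : ∀ x, ‖W (U x)‖ = ‖T x‖ := fun x => by rw [← hU, U.norm_map]
  refine ⟨fun h x hx => ?_, fun h => ?_⟩
  · have h1 : ‖W (U x)‖ = ‖U x‖ := by
      rw [hnorm, U.norm_map]
      have := inner_adjoint_apply_self T x
      rw [hx, inner_self_eq_ofReal, Complex.ofReal_inj] at this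
      exact ((sq_eq_sq₀ (norm_nonneg _) (norm_nonneg _)).1 this).symm
    have h2 : U x = 0 := by
      refine lp.ext (funext fun n => ?_)
      have h3 := hW.norm_eq_of_forall
        (fun n x => (hw n).norm_le_norm_apply (Eventually.of_forall (one_le_xi n))) h1 n
      refine E.eq_zero_of_ae_mem (measurableSet_singleton _) h ?_
      refine ((hw n).ae_eq_one (Eventually.of_forall (one_le_xi n)) ?_).mono
        fun t ht => (xi_eq_one_iff n t).1 ht
      refine (Complex.re_le_norm _).trans ((norm_inner_le_norm _ _).trans ?_)
      rw [h3, sq]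
    simpa using h2
  · refine ContinuousLinearMap.ext fun y => ?_
    set v := E.proj {oneIci} y with hv
    have h1 : w 0 v = v := by
      refine sub_eq_zero.1 (apply_eq_zero_of_nonneg
        ((hw 0).sub_one_nonneg (one_le_xi 0)) (x := v) ?_)
      rw [sub_apply, one_apply_eq_self, inner_sub_right, inner_self_eq_ofReal,
        (hw 0).inner_eq_norm_sq, sub_self]
      exact (E.ae_mem_scalar_proj (measurableSet_singleton _) y).mono
        fun t ht => (xi_eq_one_iff 0 t).2 ht
    have h2 : W (lp.single 2 0 v) = lp.single 2 1 v := by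
      refine lp.ext (funext fun n => ?_)
      rcases n with _ | n
      · rw [(hW _).1]
        simp
      · rw [(hW _).2]
        rcases n with _ | n
        · simp [h1]
        · simp
    have h3 : U.symm (lp.single 2 0 v) = 0 := by
      refine h _ (hT.adjoint_apply_eq_of_norm_eq ?_)
      rw [← hnorm, U.apply_symm_apply, h2, U.symm.norm_map, lp.norm_single (by norm_num),
        lp.norm_single (by norm_num)]
    have h4 : lp.single (E := fun _ : ℕ => M) 2 0 v = 0 := by simpa using h3
    have h5 := lp.norm_single (p := 2) (E := fun _ : ℕ => M) (by norm_num) 0 v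
    rw [h4, norm_zero] at h5
    exact norm_eq_zero.1 h5.symm

end

/-! ### Existence of a model measure -/

/-- The function `1 + n (t - 1)` on `[1, ∞)`, extended to `ℝ` by a constant. -/
noncomputable def modelDensity (n : ℕ) (t : ℝ) : ℝ := 1 + n * (max t 1 - 1)

theorem modelDensity_pos (n : ℕ) (t : ℝ) : 0 < modelDensity n t := by
  have : 0 ≤ max t 1 - 1 := sub_nonneg.2 (le_max_right _ _)
  unfold modelDensity
  positivity

@[fun_prop]
theorem continuous_modelDensity (n : ℕ) : Continuous (modelDensity n) := by
  unfold modelDensity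
  fun_prop

theorem continuous_inv_sqrt_modelDensity (n : ℕ) :
    Continuous fun t => (Real.sqrt (modelDensity n t))⁻¹ :=
  Continuous.inv₀ (by fun_prop) fun t => (Real.sqrt_pos.2 (modelDensity_pos n t)).ne'

/-- The map `t ↦ √t` from `[1, ∞)` to itself, extended to `ℝ` by a constant. -/
noncomputable def sqrtIci (t : ℝ) : Set.Ici (1 : ℝ) :=
  ⟨Real.sqrt (max t 1), Real.one_le_sqrt.2 (le_max_right _ _)⟩

theorem continuous_sqrtIci : Continuous sqrtIci := by
  unfold sqrtIci
  fun_prop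

theorem xi_sqrtIci (n : ℕ) (t : ℝ) :
    xi n (sqrtIci t) = Real.sqrt (modelDensity (n + 1) t) * (Real.sqrt (modelDensity n t))⁻¹ := by
  rw [← div_eq_mul_inv, ← Real.sqrt_div (modelDensity_pos _ _).le, xi]
  simp only [sqrtIci, modelDensity, Real.sq_sqrt (zero_le_one.trans (le_max_right t 1))]
  push_cast
  rfl

theorem measurable_xi (n : ℕ) : Measurable (xi n) := by
  unfold xi
  fun_prop

section

variable {M : Type*} [NormedAddCommGroup M] [InnerProductSpace ℂ M] [CompleteSpace M]
  {C : M →L[ℂ] M}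

theorem cfc_inv_sqrt_modelDensity_mul (hC : IsSelfAdjoint C) (n : ℕ) :
    cfc (fun t => (Real.sqrt (modelDensity n t))⁻¹) C *
      cfc (fun t => Real.sqrt (modelDensity n t)) C = 1 := by
  rw [← cfc_mul _ _ C (continuous_inv_sqrt_modelDensity n).continuousOn (by fun_prop),
    ← cfc_one ℝ C]
  exact cfc_congr fun t _ => inv_mul_cancel₀ (Real.sqrt_pos.2 (modelDensity_pos n t)).ne'

theorem cfc_sqrt_modelDensity_mul_inv (hC : IsSelfAdjoint C) (n : ℕ) :
    cfc (fun t => Real.sqrt (modelDensity n t)) C *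
      cfc (fun t => (Real.sqrt (modelDensity n t))⁻¹) C = 1 := by
  rw [← cfc_mul _ _ C (by fun_prop) (continuous_inv_sqrt_modelDensity n).continuousOn,
    ← cfc_one ℝ C]
  exact cfc_congr fun t _ => mul_inv_cancel₀ (Real.sqrt_pos.2 (modelDensity_pos n t)).ne'

/-- As `C ≥ 1`, the truncation is inactive on the spectrum and the square of the operator is `1 +
n(C - 1)`. This matches the growth of `‖Tⁿx‖²`. -/
theorem norm_sq_cfc_sqrt_modelDensity (hC : 1 ≤ C) (n : ℕ) (m : M) :
    ‖cfc (fun t => Real.sqrt (modelDensity n t)) C m‖ ^ 2 =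
      ‖m‖ ^ 2 + n * ((inner ℂ m (C m)).re - ‖m‖ ^ 2) := by
  have hsa : IsSelfAdjoint C := IsSelfAdjoint.of_nonneg (zero_le_one.trans hC)
  have h1 : cfc (fun t => Real.sqrt (modelDensity n t)) C *
      cfc (fun t => Real.sqrt (modelDensity n t)) C = 1 + (n : ℝ) • (C - 1) := by
    have h2 : cfc (fun t : ℝ => 1 + (n : ℝ) • (t - 1)) C = 1 + (n : ℝ) • (C - 1) := by
      rw [cfc_const_add _ _ C (by fun_prop), cfc_smul _ _ C (by fun_prop),
        cfc_sub _ _ C (by fun_prop) (by fun_prop), cfc_id' ℝ C, cfc_const_one ℝ C, map_one]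
    rw [← cfc_mul _ _ C (by fun_prop) (by fun_prop), ← h2]
    refine cfc_congr fun t ht => ?_
    have ht1 : 1 ≤ t := (CFC.one_le_iff (R := ℝ) C).1 hC t ht
    change Real.sqrt (modelDensity n t) * Real.sqrt (modelDensity n t) = _
    rw [Real.mul_self_sqrt (modelDensity_pos n t).le, modelDensity, max_eq_left ht1, smul_eq_mul]
  have h3 : adjoint (cfc (fun t => Real.sqrt (modelDensity n t)) C) =
      cfc (fun t => Real.sqrt (modelDensity n t)) C :=
    (cfc_predicate (R := ℝ) (p := IsSelfAdjoint) _ C)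
  have h4 := congrArg (fun S : M →L[ℂ] M => (inner ℂ m (S m)).re) h1
  change (inner ℂ m (cfc (fun t => Real.sqrt (modelDensity n t)) C
    (cfc (fun t => Real.sqrt (modelDensity n t)) C m))).re =
    (inner ℂ m (m + (n : ℝ) • (C m - m))).re at h4
  rw [← adjoint_inner_left, h3, inner_self_eq_ofReal, Complex.ofReal_re, inner_add_right,
    inner_smul_right_eq_smul, inner_sub_right, inner_self_eq_ofReal, Complex.add_re,
    Complex.smul_re, Complex.sub_re, Complex.ofReal_re] at h4
  exact h4

end

/-! ### Wold-type decomposition under the kernel condition -/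

namespace IsTwoIsometry

section

variable {H : Type*} [NormedAddCommGroup H] [InnerProductSpace ℂ H] [CompleteSpace H]
  {T : H →L[ℂ] H}

theorem adjoint_pow_pow (hT : IsTwoIsometry T) (n : ℕ) (x : H) :
    (adjoint T ^ n) ((T ^ n) x) = x + (n : ℂ) • (adjoint T (T x) - x) := by
  induction n generalizing x with
  | zero => simp
  | succ n ih =>
    rw [pow_succ' (adjoint T), pow_succ T]
    change adjoint T ((adjoint T ^ n) ((T ^ n) (T x))) = _
    rw [ih, map_add, map_smul, map_sub, hT.apply_adjoint_sq]
    push_cast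
    module

/-- Moving `Tʲ` across gives `⟨(1 + jD)x, Tᵏ⁻ʲy⟩`, and the kernel condition keeps `(1 + jD)x` in
`ker T*`. -/
theorem inner_pow_pow_eq_zero (hT : IsTwoIsometry T) (hk : KernelCondition T) {j k : ℕ}
    (hjk : j < k) {x : H} (hx : adjoint T x = 0) (y : H) :
    inner ℂ ((T ^ j) x) ((T ^ k) y) = 0 := by
  obtain ⟨i, rfl⟩ := Nat.exists_eq_add_of_lt hjk
  rw [add_assoc, pow_add T j, pow_succ' T]
  change inner ℂ ((T ^ j) x) ((T ^ j) (T ((T ^ i) y))) = 0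
  rw [← adjoint_inner_left, ← star_eq_adjoint, star_pow, star_eq_adjoint, hT.adjoint_pow_pow,
    ← adjoint_inner_left, map_add, map_smul, map_sub, hx, hk x hx]
  simp

variable {M : Type*} [NormedAddCommGroup M] [InnerProductSpace ℂ M] [CompleteSpace M]
  {ι : M →ₗᵢ[ℂ] H} {C : M →L[ℂ] M}

theorem one_le_of_intertwines (hT : IsTwoIsometry T) (hC : ∀ m, ι (C m) = adjoint T (T (ι m))) :
    1 ≤ C := by
  rw [← sub_nonneg, nonneg_iff_isPositive, isPositive_iff_complex]
  intro x
  have h := (isPositive_iff_complex _).1 ((nonneg_iff_isPositive _).1 hT.gram_sub_one_nonneg) (ι x)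
  have h1 : (adjoint T * T - 1) (ι x) = ι ((C - 1) x) := by
    change adjoint T (T (ι x)) - ι x = ι (C x - x)
    rw [map_sub, hC]
  rwa [h1, ι.inner_map_map] at h

/-- The isometry `T^n (1 + n (T*T - 1))^(-1/2)` on a subspace where `T*T` acts as `C`. -/
noncomputable def modelIsometry (hT : IsTwoIsometry T) (hC : ∀ m, ι (C m) = adjoint T (T (ι m)))
    (n : ℕ) : M →ₗᵢ[ℂ] H where
  toLinearMap := (((T ^ n).comp ι.toContinuousLinearMap).comp
    (cfc (fun t => (Real.sqrt (modelDensity n t))⁻¹) C) : M →L[ℂ] H)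
  norm_map' m := by
    have h1 := hT.one_le_of_intertwines hC
    have h2 := norm_sq_cfc_sqrt_modelDensity h1 n
      (cfc (fun t => (Real.sqrt (modelDensity n t))⁻¹) C m)
    have h3 := congrArg (fun S => S m) (cfc_sqrt_modelDensity_mul_inv
      (IsSelfAdjoint.of_nonneg (zero_le_one.trans h1)) n)
    change cfc (fun t => Real.sqrt (modelDensity n t)) C
      (cfc (fun t => (Real.sqrt (modelDensity n t))⁻¹) C m) = m at h3
    rw [h3] at h2
    set v := cfc (fun t => (Real.sqrt (modelDensity n t))⁻¹) C m with hv
    have h4 : inner ℂ v (C v) = ((‖T (ι v)‖ ^ 2 : ℝ) : ℂ) := by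
      rw [← ι.inner_map_map, hC, inner_adjoint_apply_self]
    rw [h4, Complex.ofReal_re, ← ι.norm_map v, ← hT.norm_sq_pow] at h2
    exact ((sq_eq_sq₀ (norm_nonneg _) (norm_nonneg _)).1 h2).symm

theorem modelIsometry_apply (hT : IsTwoIsometry T) (hC : ∀ m, ι (C m) = adjoint T (T (ι m)))
    (n : ℕ) (m : M) : hT.modelIsometry hC n m =
      (T ^ n) (ι (cfc (fun t => (Real.sqrt (modelDensity n t))⁻¹) C m)) :=
  rfl

theorem modelIsometry_apply_cfc (hT : IsTwoIsometry T) (hC : ∀ m, ι (C m) = adjoint T (T (ι m)))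
    (n : ℕ) (m : M) : hT.modelIsometry hC n
      (cfc (fun t => Real.sqrt (modelDensity n t)) C m) = (T ^ n) (ι m) := by
  have h := congrArg (fun S => S m) (cfc_inv_sqrt_modelDensity_mul
    (IsSelfAdjoint.of_nonneg (zero_le_one.trans (hT.one_le_of_intertwines hC))) n)
  change cfc (fun t => (Real.sqrt (modelDensity n t))⁻¹) C
    (cfc (fun t => Real.sqrt (modelDensity n t)) C m) = m at h
  rw [modelIsometry_apply, h]

/-- `T` carries the `n`-th summand into the next; the operator appearing is the `n`-th weight,
`ξₙ(√C)`. -/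
theorem apply_modelIsometry (hT : IsTwoIsometry T) (hC : ∀ m, ι (C m) = adjoint T (T (ι m)))
    (n : ℕ) (m : M) : T (hT.modelIsometry hC n m) = hT.modelIsometry hC (n + 1)
      (cfc (fun t => Real.sqrt (modelDensity (n + 1) t) * (Real.sqrt (modelDensity n t))⁻¹) C m) :=
    by
  rw [cfc_mul _ _ _ (by fun_prop) (continuous_inv_sqrt_modelDensity n).continuousOn]
  refine Eq.trans ?_ (hT.modelIsometry_apply_cfc hC (n + 1) _).symm
  rw [pow_succ']
  rfl

theorem orthogonalFamily_modelIsometry (hT : IsTwoIsometry T) (hk : KernelCondition T)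
    (hC : ∀ m, ι (C m) = adjoint T (T (ι m))) (hι : ∀ m, adjoint T (ι m) = 0) :
    OrthogonalFamily ℂ (fun _ : ℕ => M) (hT.modelIsometry hC) := by
  intro j k hjk v w
  rw [modelIsometry_apply, modelIsometry_apply]
  rcases lt_or_gt_of_ne hjk with h | h
  · exact hT.inner_pow_pow_eq_zero hk h (hι _) _
  · rw [← inner_conj_symm, hT.inner_pow_pow_eq_zero hk h (hι _), map_zero]

/-- Split `y = (y - T T'*y) + T T'*y`. The first part lies in `ker T*`, the range of the zeroth
isometry; the second is `T` applied to a vector of the previous kernel, and the span is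
`T`-invariant. -/
theorem ker_pow_le_iSup_range_modelIsometry (hT : IsTwoIsometry T)
    (hC : ∀ m, ι (C m) = adjoint T (T (ι m))) (hsurj : ∀ x, adjoint T x = 0 → ∃ m, ι m = x)
    (n : ℕ) (y : H) (hy : (adjoint (cauchyDual T) ^ n) y = 0) :
    y ∈ ⨆ i, LinearMap.range (hT.modelIsometry hC i).toLinearMap := by
  set K := ⨆ i, LinearMap.range (hT.modelIsometry hC i).toLinearMap with hK
  have hinv : K ≤ K.comap (T : H →ₗ[ℂ] H) := by
    refine iSup_le fun i => ?_
    rintro _ ⟨m, rfl⟩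
    exact Submodule.mem_iSup_of_mem (i + 1) ⟨_, (hT.apply_modelIsometry hC i m).symm⟩
  induction n generalizing y with
  | zero =>
    have : y = 0 := hy
    rw [this]
    exact K.zero_mem
  | succ n ih =>
    rw [pow_succ] at hy
    have h1 : T (adjoint (cauchyDual T) y) ∈ K := hinv (ih _ hy)
    have h2 : adjoint T (y - T (adjoint (cauchyDual T) y)) = 0 := by
      rw [map_sub, hT.adjoint_cauchyDual_apply, hT.gram_inverse_apply, sub_self]
    obtain ⟨m, hm⟩ := hsurj _ h2
    have h3 : y - T (adjoint (cauchyDual T) y) ∈ K :=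
      Submodule.mem_iSup_of_mem 0 ⟨_, (hT.modelIsometry_apply_cfc hC 0 m).trans hm⟩
    rw [← sub_add_cancel y (T (adjoint (cauchyDual T) y))]
    exact K.add_mem h3 h1

theorem isHilbertSum_modelIsometry (hT : IsTwoIsometry T) (hk : KernelCondition T)
    (hc : IsCompletelyNonUnitary T) (hC : ∀ m, ι (C m) = adjoint T (T (ι m)))
    (hι : ∀ m, adjoint T (ι m) = 0) (hsurj : ∀ x, adjoint T x = 0 → ∃ m, ι m = x) :
    IsHilbertSum ℂ (fun _ : ℕ => M) (hT.modelIsometry hC) := by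
  refine IsHilbertSum.mk (hT.orthogonalFamily_modelIsometry hk hC hι) (le_of_eq ?_)
  rw [eq_comm, Submodule.topologicalClosure_eq_top_iff, Submodule.eq_bot_iff]
  exact fun x hx => hT.eq_zero_of_orthogonal_ker hc fun n y hy =>
    hx y (hT.ker_pow_le_iSup_range_modelIsometry hC hsurj n y hy)

theorem exists_isModelMeasure_of_intertwines (hT : IsTwoIsometry T) (hk : KernelCondition T)
    (hc : IsCompletelyNonUnitary T) (hC : ∀ m, ι (C m) = adjoint T (T (ι m)))
    (hι : ∀ m, adjoint T (ι m) = 0) (hsurj : ∀ x, adjoint T x = 0 → ∃ m, ι m = x) :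
    ∃ E : OpSpectralMeasure (Set.Ici (1 : ℝ)) M, IsModelMeasure E T := by
  obtain ⟨E, hE⟩ := (IsSelfAdjoint.of_nonneg
    (zero_le_one.trans (hT.one_le_of_intertwines hC))).exists_opSpectralMeasure
  have hg : Continuous fun t : spectrum ℝ C => sqrtIci t :=
    continuous_sqrtIci.comp continuous_subtype_val
  have hV := hT.isHilbertSum_modelIsometry hk hc hC hι hsurj
  let U := hV.linearIsometryEquiv
  -- `W` is `T` transported by `U`, so it is bounded and equivalent to `T` by construction. Its
  -- coordinates need checking only on `lp.single`, by continuity.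
  let W : lp (fun _ : ℕ => M) 2 →L[ℂ] lp (fun _ : ℕ => M) 2 :=
    (U.toContinuousLinearEquiv : H →L[ℂ] _).comp
      (T.comp (U.symm.toContinuousLinearEquiv : _ →L[ℂ] H))
  let w : ℕ → M →L[ℂ] M := fun n =>
    cfc (fun t => Real.sqrt (modelDensity (n + 1) t) * (Real.sqrt (modelDensity n t))⁻¹) C
  have hW : ∀ i m, W (lp.single 2 i m) = lp.single 2 (i + 1) (w i m) := fun i m => by
    refine U.symm.injective ?_
    change U.symm (U (T (U.symm (lp.single 2 i m)))) = _
    rw [U.symm_apply_apply]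
    exact (congrArg T (hV.linearIsometryEquiv_symm_apply_single m)).trans
      ((hT.apply_modelIsometry hC i m).trans (hV.linearIsometryEquiv_symm_apply_single _).symm)
  -- `E` belongs to `C`, whereas `ξₙ` is a function of `x` with `x² = t`; hence the push-forward
  -- under the square root.
  refine ⟨E.map hg.measurable,
    ⟨Set.range fun t : spectrum ℝ C => sqrtIci t, isCompact_range hg, ?_⟩,
    w, W, U, fun n => ?_, fun h => ⟨?_, fun n => ?_⟩, fun x => ?_⟩
  · change E.proj _ = 0
    rw [Set.preimage_compl, Set.preimage_range, Set.compl_univ, E.empty]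
  · refine OpSpectralMeasure.HasIntegral.map hg.measurable (measurable_xi n) ?_
    have hcont : Continuous fun t =>
        Real.sqrt (modelDensity (n + 1) t) * (Real.sqrt (modelDensity n t))⁻¹ :=
      Continuous.mul (by fun_prop) (continuous_inv_sqrt_modelDensity n)
    have h1 : (fun t : spectrum ℝ C => xi n (sqrtIci t)) = fun t : spectrum ℝ C =>
        Real.sqrt (modelDensity (n + 1) t) * (Real.sqrt (modelDensity n t))⁻¹ :=
      funext fun t => xi_sqrtIci n t
    rw [h1]
    exact hE _ hcont
  · have h1 : (lp.evalCLM ℂ (fun _ : ℕ => M) 2 0).comp W = 0 :=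
      lp.ext_continuousLinearMap (by simp) fun i => ContinuousLinearMap.ext fun m => by
        change W (lp.single 2 i m) 0 = 0
        rw [hW]
        simp
    exact congrArg (fun S => S h) h1
  · have h1 : (lp.evalCLM ℂ (fun _ : ℕ => M) 2 (n + 1)).comp W =
        (w n).comp (lp.evalCLM ℂ (fun _ : ℕ => M) 2 n) :=
      lp.ext_continuousLinearMap (by simp) fun i => ContinuousLinearMap.ext fun m => by
        change W (lp.single 2 i m) (n + 1) = w n (lp.single (E := fun _ : ℕ => M) 2 i m n)
        rw [hW]
        rcases eq_or_ne n i with rfl | hni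
        · simp
        · simp [hni]
    exact congrArg (fun S => S h) h1
  · change _ = U (T (U.symm (U x)))
    rw [U.symm_apply_apply]

end

theorem exists_isModelMeasure {H : Type u} [NormedAddCommGroup H] [InnerProductSpace ℂ H]
    [CompleteSpace H] {T : H →L[ℂ] H} (hT : IsTwoIsometry T) (hk : KernelCondition T)
    (hc : IsCompletelyNonUnitary T) :
    ∃ (M : Type u) (_ : NormedAddCommGroup M) (_ : InnerProductSpace ℂ M) (_ : CompleteSpace M)
      (E : OpSpectralMeasure (Set.Ici (1 : ℝ)) M), IsModelMeasure E T := by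
  let M : Submodule ℂ H := (adjoint T).ker
  have hM : CompleteSpace M := (adjoint T).isClosed_ker.completeSpace_coe
  let C : M →L[ℂ] M :=
    ((adjoint T * T).comp M.subtypeL).codRestrict M fun x => hk x x.2
  obtain ⟨E, hE⟩ := hT.exists_isModelMeasure_of_intertwines (ι := M.subtypeₗᵢ) (C := C) hk hc
    (fun _ => rfl) (fun m => m.2) (fun x hx => ⟨⟨x, hx⟩, rfl⟩)
  exact ⟨M, inferInstance, inferInstance, hM, E, hE⟩

end IsTwoIsometry

/-! ### Assembly of the equivalences -/

theorem theorem5p3 {H : Type u} [NormedAddCommGroup H] [InnerProductSpace ℂ H]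
    [CompleteSpace H] (T : H →L[ℂ] H) (hT : IsTwoIsometry T) :
    (IsClassCDotZero (cauchyDual T) ↔ IsCompletelyNonUnitary T) ∧
    (KernelCondition T →
      (IsClassCZeroDot (cauchyDual T) ↔
        IsCompletelyNonUnitary T ∧
          ∃ (M : Type u) (_ : NormedAddCommGroup M) (_ : InnerProductSpace ℂ M)
            (_ : CompleteSpace M) (E : OpSpectralMeasure (Set.Ici (1 : ℝ)) M),
            IsModelMeasure E T ∧ E.proj {oneIci} = 0) ∧
      (IsClassCZeroDot (cauchyDual T) ↔
        IsCompletelyNonUnitary T ∧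
          ∀ (M : Type u) (_ : NormedAddCommGroup M) (_ : InnerProductSpace ℂ M)
            (_ : CompleteSpace M) (E : OpSpectralMeasure (Set.Ici (1 : ℝ)) M),
            IsModelMeasure E T → E.proj {oneIci} = 0) ∧
      (IsClassCZeroDot (cauchyDual T) ↔ IsClassCZeroZero (cauchyDual T)) ∧
      (IsClassCZeroDot (cauchyDual T) ↔
        ∃ G : OpSpectralMeasure ℝ H,
          IsSpectralMeasureOf G (adjoint T * T) ∧ G.proj {1} = 0) ∧
      (IsClassCZeroDot (cauchyDual T) ↔
        ∀ G : OpSpectralMeasure ℝ H,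
          IsSpectralMeasureOf G (adjoint T * T) → G.proj {1} = 0)) := by
  have hi := hT.isClassCDotZero_cauchyDual_iff
  refine ⟨hi, fun hk => ?_⟩
  have h0 := hT.isClassCZeroDot_cauchyDual_iff hk
  have hcnu : IsClassCZeroDot (cauchyDual T) → IsCompletelyNonUnitary T := fun h =>
    hT.isCompletelyNonUnitary_of_fixed_eq_zero (h0.1 h)
  refine ⟨⟨fun h => ⟨hcnu h, ?_⟩, ?_⟩, ⟨fun h => ⟨hcnu h, ?_⟩, ?_⟩,
    ⟨fun h => ⟨h, hi.2 (hcnu h)⟩, fun h => h.1⟩, ⟨fun h => ?_, ?_⟩, ⟨fun h G hG => ?_, fun h => ?_⟩⟩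
  · obtain ⟨M, _, _, _, E, hE⟩ := hT.exists_isModelMeasure hk (hcnu h)
    exact ⟨M, _, _, _, E, hE, (hT.proj_oneIci_eq_zero_iff hE).2 (h0.1 h)⟩
  · rintro ⟨-, M, _, _, _, E, hE, hE1⟩
    exact h0.2 ((hT.proj_oneIci_eq_zero_iff hE).1 hE1)
  · intro M _ _ _ E hE
    exact (hT.proj_oneIci_eq_zero_iff hE).2 (h0.1 h)
  · rintro ⟨hc, h⟩
    obtain ⟨M, _, _, _, E, hE⟩ := hT.exists_isModelMeasure hk hc
    exact h0.2 ((hT.proj_oneIci_eq_zero_iff hE).1 (h M _ _ _ E hE))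
  · obtain ⟨G, hG⟩ := (IsSelfAdjoint.star_mul_self T).exists_isSpectralMeasureOf
    exact ⟨G, hG, (hT.proj_one_eq_zero_iff hG).2 (h0.1 h)⟩
  · rintro ⟨G, hG, hG1⟩
    exact h0.2 ((hT.proj_one_eq_zero_iff hG).1 hG1)
  · exact (hT.proj_one_eq_zero_iff hG).2 (h0.1 h)
  · obtain ⟨G, hG⟩ := (IsSelfAdjoint.star_mul_self T).exists_isSpectralMeasureOf
    exact h0.2 ((hT.proj_one_eq_zero_iff hG).1 (h G hG))
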